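/- Let $\ell\ge 0$. For $\underline p=(p_1,\dots,p_{\ell+1})\in\mathbb Z^{\ell+1}$ let $\mathcal P(\underline p)$ be the finite set of Gelfand–Zetlin patterns with top row $\underline p$, i.e. of integer arrays $(p_{k,i})_{1\le i\le k\le \ell+1}$ with $p_{\ell+1,i}=p_i$ and $p_{k+1,i}\le p_{k,i}\le p_{k+1,i+1}$ for $1\le i\le k\le\ell$; put $s_k=\sum_{i=1}^k p_{k,i}$, $s_0=0$. For $0<q<1$ let $(n)_q!=(1-q)(1-q^2)\cdots(1-q^n)$. For $\underline\lambda\in\mathbb C^{\ell+1}$ the $q$-deformed $\mathfrak{gl}_{\ell+1}$-Whittaker function is $$\Psi_{\underline\lambda}(\underline p)=\sum_{(p_{k,i})\in\mathcal P(\underline p)}\ \prod_{k=1}^{\ell+1}q^{\lambda_k(s_k-s_{k-1})}\cdot\frac{\prod_{k=2}^{\ell}\prod_{i=1}^{k-1}(p_{k,i+1}-p_{k,i})_q!}{\prod_{k=1}^{\ell}\prod_{i=1}^{k}(p_{k,i}-p_{k+1,i})_q!\,(p_{k+1,i+1}-p_{k,i})_q!}$$ if $p_1\le\dots\le p_{\ell+1}$,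 and $\Psi_{\underline\lambda}(\underline p)=0$ otherwise. For $\underline z\in(\mathbb C^*)^{\ell+1}$ put $$\chi_{\underline p}(\underline z)=\sum_{(p_{k,i})\in\mathcal P(\underline p)}\ \prod_{k=1}^{\ell+1}z_k^{\,s_k-s_{k-1}}$$ if $p_1\le\dots\le p_{\ell+1}$, and $\chi_{\underline p}(\underline z)=0$ otherwise. Let $\underline p\in\mathbb Z^{\ell+1}$ with $p_1\le\dots\le p_{\ell+1}$. Then: 1. For every $\underline z\in(\mathbb C^*)^{\ell+1}$, if $q\to0^+$ and $\underline\lambda=\underline\lambda(q)\in\mathbb C^{\ell+1}$ varies with $q$ so that $q^{\lambda_i}=z_i$ stays fixed for $i=1,\dots,\ell+1$, then $\Psi_{\underline\lambda}(\underline p)\to\chi_{\underline p}(\underline z)$. 2. For $1\le r\le\ell+1$ let $\chi_r(\underline z)$ be the character of the fundamental representation $\bigwedge^r\mathbb C^{\ell+1}$ at $\mathrm{diag}(z_1,\dots,z_{\ell+1})$. Then, for every $\underline z\in(\mathbb C^*)^{\ell+1}$, $\chi_r(\underline z)=e_r(\underline z)=\sum_{I}\prod_{i\in I}z_i$ and $$\chi_r(\underline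 z)\,\chi_{\underline p}(\underline z)=\sum_{I}\chi_{\underline p+I}(\underline z),$$ where both sums are over the subsets $I\subset\{1,\dots,\ell+1\}$ with $r$ elements, and $\underline p+I$ is obtained from $\underline p$ by adding $1$ to the coordinates $p_i$, $i\in I$. 3. There is an irreducible finite-dimensional rational representation of $GL_{\ell+1}(\mathbb C)$ with highest weight $(p_{\ell+1},p_\ell,\dots,p_1)$ (with respect to the upper triangular Borel subgroup), and every such representation has character $\chi_{\underline p}$: the trace of $\mathrm{diag}(z_1,\dots,z_{\ell+1})$ in it equals $\chi_{\underline p}(\underline z)$ for all $\underline z\in(\mathbb C^*)^{\ell+1}$. -/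

import Mathlib

open Filter Topology

namespace QWhittaker

/-- Gelfand–Zetlin patterns with top row `p`. A pattern is a triangular array of integers `P k i`,
`1 ≤ i ≤ k ≤ ℓ + 1`, extended by zero to all of `ℕ × ℕ`; the interlacing conditions are
`P (k+1) i ≤ P k i ≤ P (k+1) (i+1)`. The top row is `P (ℓ+1) (i+1) = p i` for `i : Fin (ℓ+1)`. -/
def gzPatterns (ℓ : ℕ) (p : Fin (ℓ + 1) → ℤ) : Set (ℕ → ℕ → ℤ) :=
  {P | (∀ i : Fin (ℓ + 1), P (ℓ + 1) (i + 1) = p i) ∧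
    (∀ k i, 1 ≤ i → i ≤ k → k ≤ ℓ → P (k + 1) i ≤ P k i ∧ P k i ≤ P (k + 1) (i + 1)) ∧
    (∀ k i, ¬ (1 ≤ i ∧ i ≤ k ∧ k ≤ ℓ + 1) → P k i = 0)}

theorem gzPatterns_finite (ℓ : ℕ) (p : Fin (ℓ + 1) → ℤ) : (gzPatterns ℓ p).Finite := by
  set B : ℤ := ∑ i, |p i| with hB
  have hB0 : 0 ≤ B := Finset.sum_nonneg fun i _ => abs_nonneg _
  let F : (Fin (ℓ + 2) → Fin (ℓ + 2) → ℤ) → (ℕ → ℕ → ℤ) := fun f k i =>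
    if h : k < ℓ + 2 ∧ i < ℓ + 2 then f ⟨k, h.1⟩ ⟨i, h.2⟩ else 0
  refine ((Set.finite_Icc (fun _ _ => -B) (fun _ _ => B)).image F).subset ?_
  rintro P ⟨htop, hint, hzero⟩
  have key : ∀ d k, k + d = ℓ + 1 → ∀ i, 1 ≤ i → i ≤ k → -B ≤ P k i ∧ P k i ≤ B := by
    intro d
    induction d with
    | zero =>
      intro k hk i hi1 hik
      have hk' : k = ℓ + 1 := by omega
      subst hk'
      have h := htop ⟨i - 1, by omega⟩
      have hi : i - 1 + 1 = i := by omega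
      simp only [hi] at h
      rw [h]
      have h2 : |p ⟨i - 1, by omega⟩| ≤ B :=
        Finset.single_le_sum (f := fun j => |p j|) (fun j _ => abs_nonneg _) (Finset.mem_univ _)
      exact abs_le.mp h2
    | succ d ih =>
      intro k hk i hi1 hik
      have h1 := ih (k + 1) (by omega) i hi1 (by omega)
      have h2 := ih (k + 1) (by omega) (i + 1) (by omega) (by omega)
      have h3 := hint k i hi1 hik (by omega)
      constructor <;> linarith [h1.1, h2.2, h3.1, h3.2]
  have bd : ∀ k i, -B ≤ P k i ∧ P k i ≤ B := by
    intro k i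
    by_cases h : 1 ≤ i ∧ i ≤ k ∧ k ≤ ℓ + 1
    · exact key (ℓ + 1 - k) k (by omega) i h.1 h.2.1
    · rw [hzero k i h]; constructor <;> linarith
  refine ⟨fun k i => P k i, ⟨fun k i => (bd k i).1, fun k i => (bd k i).2⟩, ?_⟩
  funext k i
  by_cases h : k < ℓ + 2 ∧ i < ℓ + 2
  · simp [F, h]
  · simp only [F, h, dite_false]
    exact (hzero k i (by omega)).symm

/-- The sum `∑_{i=1}^k P_{k,i}` of the `k`-th row (zero for `k = 0`). -/
def rowSum (P : ℕ → ℕ → ℤ) (k : ℕ) : ℤ := ∑ i ∈ Finset.Icc 1 k, P k i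

/-- `(n)_q! = (1 - q) ⋯ (1 - q ^ n)`; it is only used for `n ≥ 0`. -/
def qFactorial (q : ℝ) (n : ℤ) : ℝ := ∏ j ∈ Finset.Icc 1 n.toNat, (1 - q ^ j)

/-- The ratio of `q`-factorials with which a pattern is weighted in the `q`-Whittaker function. -/
noncomputable def qWeight (ℓ : ℕ) (q : ℝ) (P : ℕ → ℕ → ℤ) : ℝ :=
  (∏ k ∈ Finset.Icc 2 ℓ, ∏ i ∈ Finset.Icc 1 (k - 1), qFactorial q (P k (i + 1) - P k i)) /
    ∏ k ∈ Finset.Icc 1 ℓ, ∏ i ∈ Finset.Icc 1 k,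
      (qFactorial q (P k i - P (k + 1) i) * qFactorial q (P (k + 1) (i + 1) - P k i))

open Classical in
/-- The `q`-deformed `𝔤𝔩_{ℓ+1}`-Whittaker function `Ψ_λ(p)` on the lattice `ℤ^{ℓ+1}`. The spectral
parameters may be complex; `lam k` stands for `λ_{k+1}`. -/
noncomputable def qWhittakerFun (ℓ : ℕ) (q : ℝ) (lam : Fin (ℓ + 1) → ℂ) (p : Fin (ℓ + 1) → ℤ) :
    ℂ :=
  if Monotone p then
    ∑ P ∈ (gzPatterns_finite ℓ p).toFinset,
      (∏ k : Fin (ℓ + 1), (q : ℂ) ^ (lam k * ((rowSum P (k + 1) - rowSum P k : ℤ) : ℂ))) *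
        (qWeight ℓ q P : ℂ)
  else 0

open Classical in
/-- The Gelfand–Zetlin generating sum `χ_p(z)` for `p_1 ≤ ⋯ ≤ p_{ℓ+1}`, zero for other `p`. -/
noncomputable def gzChar (ℓ : ℕ) (p : Fin (ℓ + 1) → ℤ) (z : Fin (ℓ + 1) → ℂˣ) : ℂ :=
  if Monotone p then
    ∑ P ∈ (gzPatterns_finite ℓ p).toFinset,
      ∏ k : Fin (ℓ + 1), (z k : ℂ) ^ (rowSum P (k + 1) - rowSum P k)
  else 0

/-- The character of the fundamental representation `⋀^r ℂ^n` at the diagonal matrix of `z`. -/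
noncomputable def fundChar {n : ℕ} (r : ℕ) (z : Fin n → ℂˣ) : ℂ :=
  LinearMap.trace ℂ (⋀[ℂ]^r (Fin n → ℂ))
    (exteriorPower.map r (Matrix.toLin' (Matrix.diagonal fun i => (z i : ℂ))))

/-- The element `p + I` of the lattice: `1` is added to the coordinates in `I`. -/
def shift {n : ℕ} (p : Fin n → ℤ) (I : Finset (Fin n)) : Fin n → ℤ :=
  fun i => p i + if i ∈ I then 1 else 0

/-- The diagonal matrix of `z` as an element of `GL_n(ℂ)`. -/
noncomputable def torusElt {n : ℕ} (z : Fin n → ℂˣ) : Matrix.GeneralLinearGroup (Fin n) ℂ :=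
  Matrix.GeneralLinearGroup.mkOfDetNeZero (Matrix.diagonal fun i => (z i : ℂ)) (by
    rw [Matrix.det_diagonal]
    exact Finset.prod_ne_zero_iff.mpr fun i _ => (z i).ne_zero)

section Representations

variable {n : ℕ} {V : Type*} [AddCommGroup V] [Module ℂ V]

/-- A representation of `GL_n(ℂ)` is rational if each matrix coefficient is a polynomial in the
entries of the matrix divided by a power of its determinant. -/
def IsRational (ρ : Representation ℂ (Matrix.GeneralLinearGroup (Fin n) ℂ) V) : Prop :=
  ∀ (f : Module.Dual ℂ V) (v : V), ∃ (Q : MvPolynomial (Fin n × Fin n) ℂ) (N : ℕ),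
    ∀ g : Matrix.GeneralLinearGroup (Fin n) ℂ,
      f (ρ g v) = MvPolynomial.eval (fun ij => (g : Matrix (Fin n) (Fin n) ℂ) ij.1 ij.2) Q /
        (g : Matrix (Fin n) (Fin n) ℂ).det ^ N

/-- There is a highest weight vector of weight `w`: a nonzero vector on which every invertible
upper triangular matrix `b` acts by the scalar `∏ i, (b i i) ^ (w i)`. -/
def HasHighestWeight (ρ : Representation ℂ (Matrix.GeneralLinearGroup (Fin n) ℂ) V)
    (w : Fin n → ℤ) : Prop :=
  ∃ v : V, v ≠ 0 ∧ ∀ b : Matrix.GeneralLinearGroup (Fin n) ℂ,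
    (∀ i j, j < i → (b : Matrix (Fin n) (Fin n) ℂ) i j = 0) →
      ρ b v = (∏ i, (b : Matrix (Fin n) (Fin n) ℂ) i i ^ w i) • v

/-- An irreducible finite-dimensional rational representation of `GL_n(ℂ)` of highest
weight `w`. -/
structure IsIrrepOfHighestWeight
    (ρ : Representation ℂ (Matrix.GeneralLinearGroup (Fin n) ℂ) V) (w : Fin n → ℤ) : Prop where
  finite : FiniteDimensional ℂ V
  rational : IsRational ρ
  irreducible : ρ.IsIrreducible
  highestWeight : HasHighestWeight ρ w

end Representations

end QWhittaker

/-! The limit is taken termwise: each `q`-factorial is a polynomial in `q` with value 1 at `q = 0`,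
so every pattern's weight tends to 1, while `q ^ (λ m) = z ^ m` for integer `m`.

The other claims rest on the bialternant formula `alternant_mul_gzLaurent`: with `a_ν = det (z_i ^
ν_j)` and `δ = (0, 1, …, ℓ)`, one has `a_δ χ_p = a_{p+δ}`. Removing the top row of a pattern
expresses `χ_p` through the `χ_r` with `r` interlacing `p`, and column operations on the alternant
give the same recursion up to the factor by which the Vandermonde determinant `a_δ` grows.

For the Pieri rule, `e_r a_ν` is the sum of the `a_{ν+I}`. If `p + I` is not increasing, `p + I + δ`
has a repeated exponent and its alternant vanishes. Cancelling `a_δ` in the domain of Laurent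
polynomials gives the rule.

For the character `X` of an irreducible representation of highest weight `w`, differentiate the
group action. Irreducibility makes lowering operators applied to the highest weight vector `v` span
the space (`lowerSpan_eq_top`). Hence all weights are dominated by `w`, `w` has multiplicity one,
and the Casimir operator is a scalar (`casimir_eq_smul`). Taking the trace of the Casimir operator
against the torus turns this into a differential equation: `a_δ X` is an eigenfunction of `∑ (z_i
∂_i)²` (`laplace_alternant_mul_trace`). So all exponents of the antisymmetric `a_δ X` have the same
norm as its leading exponent, the reversal of `p + δ`. A decreasing exponent dominated by that one
and of equal norm must equal it, so `a_δ X = a_{p+δ} = a_δ χ_p`, and `a_δ` cancels.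

For existence, a product of powers of leading principal minors and of the determinant is an
eigenfunction of right translation by upper triangular matrices. Its translates span a
finite-dimensional rational representation generated by a highest weight vector, and an irreducible
quotient is taken. -/

namespace QWhittaker

/-! ### Laurent polynomials as functions on the torus -/

/-- The algebra of Laurent polynomials in `n` variables. -/
abbrev Laurent (n : ℕ) := AddMonoidAlgebra ℂ (Fin n → ℤ)

/-- The character `z ↦ ∏ i, z i ^ μ i` of the torus. -/
noncomputable def torusChar {n : ℕ} (μ : Fin n → ℤ) : (Fin n → ℂˣ) →* ℂ where
  toFun z := ∏ i, (z i : ℂ) ^ μ i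
  map_one' := by simp
  map_mul' z y := by simp [mul_zpow, Finset.prod_mul_distrib]

theorem torusChar_apply {n : ℕ} (μ : Fin n → ℤ) (z : Fin n → ℂˣ) :
    torusChar μ z = ∏ i, (z i : ℂ) ^ μ i := rfl

theorem torusChar_zero {n : ℕ} (z : Fin n → ℂˣ) : torusChar 0 z = 1 := by
  simp [torusChar_apply]

theorem torusChar_add {n : ℕ} (μ ν : Fin n → ℤ) (z : Fin n → ℂˣ) :
    torusChar (μ + ν) z = torusChar μ z * torusChar ν z := by
  simp only [torusChar_apply, Pi.add_apply, ← Finset.prod_mul_distrib]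
  exact Finset.prod_congr rfl fun i _ => zpow_add₀ (z i).ne_zero _ _

theorem torusChar_single {n : ℕ} (i : Fin n) (m : ℤ) (z : Fin n → ℂˣ) :
    torusChar (Pi.single i m) z = (z i : ℂ) ^ m := by
  rw [torusChar_apply, Finset.prod_eq_single i]
  · simp
  · intro j _ hj
    simp [Pi.single_eq_of_ne hj]
  · simp

theorem torusChar_mulSingle {n : ℕ} (μ : Fin n → ℤ) (i : Fin n) (u : ℂˣ) :
    torusChar μ (Pi.mulSingle i u) = (u : ℂ) ^ μ i := by
  rw [torusChar_apply, Finset.prod_eq_single i]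
  · simp
  · intro j _ hj
    simp [Pi.mulSingle_eq_of_ne hj]
  · simp

theorem torusChar_injective (n : ℕ) : Function.Injective (torusChar (n := n)) := by
  intro μ ν h
  funext i
  have h1 := DFunLike.congr_fun h (Pi.mulSingle i (Units.mk0 (2 : ℂ) two_ne_zero))
  rw [torusChar_mulSingle, torusChar_mulSingle, Units.val_mk0] at h1
  -- Norms bring the equation to the ordered field `ℝ`, where powers of 2 determine the exponent.
  have h2 : (2 : ℝ) ^ μ i = (2 : ℝ) ^ ν i := by
    have h3 := congrArg (fun x : ℂ => ‖x‖) h1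
    simpa using h3
  exact zpow_right_injective₀ (by norm_num) (by norm_num) h2

/-- Dedekind's independence of characters. It allows identities of Laurent polynomials to be checked
at points of the torus, and coefficients to be compared afterwards. -/
theorem torusChar_linearIndependent (n : ℕ) :
    LinearIndependent ℂ fun μ : Fin n → ℤ => (torusChar μ : (Fin n → ℂˣ) → ℂ) :=
  (linearIndependent_monoidHom (Fin n → ℂˣ) ℂ).comp _ (torusChar_injective n)

/-- A vector-valued Laurent polynomial is determined by its values. -/
theorem finsupp_ext_of_torus {n : ℕ} {W : Type*} [AddCommGroup W] [Module ℂ W]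
    {P Q : (Fin n → ℤ) →₀ W}
    (h : ∀ z : Fin n → ℂˣ, (P.sum fun μ w => torusChar μ z • w) =
      Q.sum fun μ w => torusChar μ z • w) : P = Q := by
  rw [← sub_eq_zero]
  set R := P - Q with hR
  have hz : ∀ z : Fin n → ℂˣ, (R.sum fun μ w => torusChar μ z • w) = 0 := by
    intro z
    rw [hR, Finsupp.sum_sub_index, h z, sub_self]
    intros; rw [smul_sub]
  ext μ
  rw [Finsupp.zero_apply, ← Module.forall_dual_apply_eq_zero_iff ℂ]
  intro f
  have hl := linearIndependent_iff.mp (torusChar_linearIndependent n)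
    (R.mapRange f (map_zero f)) (by
      funext z
      rw [Finsupp.linearCombination_apply, Finsupp.sum_mapRange_index (by simp)]
      have := congrArg f (hz z)
      rw [map_finsuppSum, map_zero] at this
      simp only [map_smul, smul_eq_mul] at this
      rw [Finsupp.sum, Finset.sum_apply]
      simpa [Finsupp.sum, mul_comm] using this)
  simpa using DFunLike.congr_fun hl μ

/-- Evaluation of Laurent polynomials at a point of the torus. -/
noncomputable def ev {n : ℕ} (z : Fin n → ℂˣ) : Laurent n →ₐ[ℂ] ℂ :=
  AddMonoidAlgebra.lift ℂ ℂ (Fin n → ℤ)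
    { toFun := fun μ => torusChar μ.toAdd z
      map_one' := torusChar_zero z
      map_mul' := fun _ _ => torusChar_add _ _ z }

theorem ev_single {n : ℕ} (z : Fin n → ℂˣ) (μ : Fin n → ℤ) (c : ℂ) :
    ev z (AddMonoidAlgebra.single μ c) = c * torusChar μ z := by
  simp [ev, AddMonoidAlgebra.lift_single]

theorem ev_eq_sum {n : ℕ} (z : Fin n → ℂˣ) (f : Laurent n) :
    ev z f = f.coeff.sum fun μ c => torusChar μ z • c := by
  conv_lhs => rw [← AddMonoidAlgebra.sum_coeff_single f]
  rw [map_finsuppSum]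
  simp only [ev_single, smul_eq_mul, mul_comm]

theorem ev_ext {n : ℕ} {f g : Laurent n} (h : ∀ z, ev z f = ev z g) : f = g :=
  AddMonoidAlgebra.coeff_injective
    (finsupp_ext_of_torus fun z => by rw [← ev_eq_sum, ← ev_eq_sum, h z])

theorem torusChar_comp {n : ℕ} (σ : Equiv.Perm (Fin n)) (μ : Fin n → ℤ) (z : Fin n → ℂˣ) :
    torusChar (μ ∘ σ) (z ∘ σ) = torusChar μ z := by
  simp only [torusChar_apply, Function.comp_apply]
  exact Equiv.prod_comp σ fun i => (z i : ℂ) ^ μ i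

/-- Equivariance of values under a permutation passes to the coefficients. -/
theorem coeff_comp_of_ev_comp {n : ℕ} {f : Laurent n} {σ : Equiv.Perm (Fin n)} {c : ℂ}
    (h : ∀ z, ev (z ∘ σ) f = c * ev z f) (μ : Fin n → ℤ) :
    f.coeff (μ ∘ σ) = c * f.coeff μ := by
  let e : (Fin n → ℤ) ≃ (Fin n → ℤ) := Equiv.arrowCongr σ (Equiv.refl ℤ)
  have he : ∀ ν, e ν = ν ∘ σ.symm := fun ν => rfl
  have hP : f.coeff.mapDomain e = (c • f).coeff := by
    refine finsupp_ext_of_torus fun z => ?_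
    rw [← ev_eq_sum z (c • f), map_smul, smul_eq_mul, ← h, ev_eq_sum, Finsupp.sum_mapDomain_index
      (by simp) (by simp [mul_add])]
    refine Finset.sum_congr rfl fun ν _ => ?_
    dsimp only
    rw [← torusChar_comp σ (e ν) z]
    have hν : e ν ∘ σ = ν := by funext i; simp [he]
    rw [hν]
  have h1 := DFunLike.congr_fun hP (e (μ ∘ σ))
  rw [Finsupp.mapDomain_apply e.injective] at h1
  rw [h1]
  have : e (μ ∘ σ) = μ := by funext i; simp [he]
  rw [this]; rfl

/-! ### Derivations -/

/-- The derivation `z i ∂/∂(z i)` of the algebra of Laurent polynomials. -/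
noncomputable def eulerD {n : ℕ} (i : Fin n) : Laurent n →ₗ[ℂ] Laurent n where
  toFun f := AddMonoidAlgebra.ofCoeff (Finsupp.onFinset f.coeff.support
    (fun μ => (μ i : ℂ) * f.coeff μ) fun μ h => by
      rw [Finsupp.mem_support_iff]; exact right_ne_zero_of_mul h)
  map_add' f g := by ext μ; simp [mul_add]
  map_smul' c f := by ext μ; simp; ring

theorem eulerD_coeff {n : ℕ} (i : Fin n) (f : Laurent n) (μ : Fin n → ℤ) :
    (eulerD i f).coeff μ = (μ i : ℂ) * f.coeff μ := rfl

theorem eulerD_single {n : ℕ} (i : Fin n) (μ : Fin n → ℤ) (c : ℂ) :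
    eulerD i (AddMonoidAlgebra.single μ c) = (μ i : ℂ) • AddMonoidAlgebra.single μ c := by
  ext ν
  rw [eulerD_coeff]
  simp only [AddMonoidAlgebra.coeff_smul, Finsupp.smul_apply, AddMonoidAlgebra.coeff_single,
    smul_eq_mul]
  by_cases h : μ = ν
  · subst h; rfl
  · simp [h]

theorem eulerD_mul {n : ℕ} (i : Fin n) (f g : Laurent n) :
    eulerD i (f * g) = eulerD i f * g + f * eulerD i g := by
  induction f using AddMonoidAlgebra.induction_linear with
  | zero => simp
  | add f₁ f₂ h₁ h₂ => simp only [add_mul, map_add, h₁, h₂]; ring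
  | single μ c =>
    induction g using AddMonoidAlgebra.induction_linear with
    | zero => simp
    | add f₁ f₂ h₁ h₂ => simp only [mul_add, map_add, h₁, h₂]; ring
    | single ν d =>
      rw [AddMonoidAlgebra.single_mul_single, eulerD_single, eulerD_single, eulerD_single,
        smul_mul_assoc, mul_smul_comm, AddMonoidAlgebra.single_mul_single, ← add_smul]
      simp

theorem eulerD_prod {n : ℕ} {ι : Type*} [DecidableEq ι] (i : Fin n) (s : Finset ι)
    (f : ι → Laurent n) :
    eulerD i (∏ a ∈ s, f a) = ∑ a ∈ s, eulerD i (f a) * ∏ b ∈ s.erase a, f b := by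
  induction s using Finset.induction_on with
  | empty =>
    rw [Finset.prod_empty, Finset.sum_empty, AddMonoidAlgebra.one_def, eulerD_single]
    simp
  | insert a s ha ih =>
    rw [Finset.prod_insert ha, eulerD_mul, Finset.sum_insert ha, Finset.erase_insert ha, ih,
      Finset.mul_sum]
    congr 1
    refine Finset.sum_congr rfl fun b hb => ?_
    have hab : a ≠ b := fun h => ha (h ▸ hb)
    rw [Finset.erase_insert_of_ne hab, Finset.prod_insert (fun h => ha (Finset.mem_of_mem_erase h))]
    ring

/-! ### Alternants -/

/-- The variable `z i` as a Laurent polynomial. -/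
noncomputable def lvar {n : ℕ} (i : Fin n) : Laurent n :=
  AddMonoidAlgebra.single (Pi.single i 1) 1

theorem ev_lvar {n : ℕ} (z : Fin n → ℂˣ) (i : Fin n) : ev z (lvar i) = z i := by
  simp [lvar, ev_single, torusChar_single]

/-- The alternant `det (z i ^ ν j)`. -/
noncomputable def alternant {n : ℕ} (ν : Fin n → ℤ) : Laurent n :=
  (Matrix.of fun i j : Fin n =>
    (AddMonoidAlgebra.single (Pi.single i (ν j)) 1 : Laurent n)).det

/-- The exponents `0, 1, …, n - 1`. -/
def delta (n : ℕ) : Fin n → ℤ := fun j => (j : ℤ)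

theorem ev_alternant {n : ℕ} (ν : Fin n → ℤ) (z : Fin n → ℂˣ) :
    ev z (alternant ν) = (Matrix.of fun i j : Fin n => (z i : ℂ) ^ ν j).det := by
  rw [alternant, AlgHom.map_det]
  congr 1
  ext i j
  simp [ev_single, torusChar_single]

theorem alternant_eq_sum {n : ℕ} (ν : Fin n → ℤ) :
    alternant ν = ∑ σ : Equiv.Perm (Fin n), ((Equiv.Perm.sign σ : ℤ) : ℂ) •
      AddMonoidAlgebra.single (ν ∘ σ) 1 := by
  refine ev_ext fun z => ?_
  rw [ev_alternant, ← Matrix.det_transpose, Matrix.det_apply', map_sum]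
  refine Finset.sum_congr rfl fun σ _ => ?_
  rw [map_smul, ev_single, smul_eq_mul, one_mul]
  rfl

theorem ev_alternant_comp {n : ℕ} (ν : Fin n → ℤ) (σ : Equiv.Perm (Fin n)) (z : Fin n → ℂˣ) :
    ev (z ∘ σ) (alternant ν) = ((Equiv.Perm.sign σ : ℤ) : ℂ) * ev z (alternant ν) := by
  rw [ev_alternant, ev_alternant, ← Matrix.det_permute]
  rfl

theorem alternant_delta_eq_prod (n : ℕ) :
    alternant (delta n) = ∏ i : Fin n, ∏ j ∈ Finset.Ioi i, (lvar j - lvar i) := by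
  rw [← Matrix.det_vandermonde]
  refine ev_ext fun z => ?_
  rw [ev_alternant, AlgHom.map_det]
  congr 1
  ext i j
  simp [Matrix.vandermonde, ev_lvar, delta]

theorem alternant_delta_ne_zero (n : ℕ) : alternant (delta n) ≠ 0 := by
  rw [alternant_delta_eq_prod, Finset.prod_ne_zero_iff]
  intro i _
  rw [Finset.prod_ne_zero_iff]
  intro j hj
  rw [sub_ne_zero, lvar, lvar, Ne, AddMonoidAlgebra.single_left_inj one_ne_zero]
  intro h
  have := congrFun h j
  rw [Pi.single_eq_same, Pi.single_eq_of_ne (Finset.mem_Ioi.mp hj).ne'] at this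
  exact one_ne_zero this

/-! ### Gelfand–Zetlin sums and alternants -/

theorem sum_Icc_int_telescope {M : Type*} [AddCommGroup M] (g : ℤ → M) {a b : ℤ} (h : a ≤ b) :
    ∑ m ∈ Finset.Icc a b, (g m - g (m + 1)) = g a - g (b + 1) := by
  induction b, h using Int.leInduction with
  | base => simp
  | succ b hb ih =>
    have hins : Finset.Icc a (b + 1) = insert (b + 1) (Finset.Icc a b) := by
      ext m; simp only [Finset.mem_Icc, Finset.mem_insert]; omega
    rw [hins, Finset.sum_insert (by simp), ih]
    abel

theorem zpow_finset_sum {K ι : Type*} [Field K] {a : K} (ha : a ≠ 0) (s : Finset ι) (f : ι → ℤ) :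
    a ^ (∑ j ∈ s, f j) = ∏ j ∈ s, a ^ f j := by
  classical
  induction s using Finset.induction_on with
  | empty => simp
  | insert b s hb ih => rw [Finset.sum_insert hb, Finset.prod_insert hb, zpow_add₀ ha, ih]

/-- The box of rows interlacing with the row `p`. -/
noncomputable def interlacingRows {n : ℕ} (p : Fin (n + 1) → ℤ) : Finset (Fin n → ℤ) :=
  Fintype.piFinset fun j => Finset.Icc (p j.castSucc) (p j.succ)

theorem mem_interlacingRows {n : ℕ} {p : Fin (n + 1) → ℤ} {r : Fin n → ℤ} :
    r ∈ interlacingRows p ↔ ∀ j, p j.castSucc ≤ r j ∧ r j ≤ p j.succ := by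
  simp [interlacingRows]

theorem monotone_of_mem_interlacingRows {n : ℕ} {p : Fin (n + 1) → ℤ} {r : Fin n → ℤ}
    (h : r ∈ interlacingRows p) : Monotone r := by
  rw [mem_interlacingRows] at h
  cases n with
  | zero => exact fun i => i.elim0
  | succ n =>
    rw [Fin.monotone_iff_le_succ]
    intro i
    have h1 := (h i.castSucc).2
    have h2 := (h i.succ).1
    rw [Fin.succ_castSucc] at h1
    exact h1.trans h2

/-- Branching of alternants. -/
theorem ev_alternant_succ {n : ℕ} (p : Fin (n + 1) → ℤ) (hp : Monotone p)
    (z : Fin (n + 1) → ℂˣ) :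
    ev z (alternant (p + delta (n + 1))) =
      (∏ i : Fin n, ((z (Fin.last n) : ℂ) - z i.castSucc)) *
        ∑ r ∈ interlacingRows p, ev (fun i => z i.castSucc) (alternant (r + delta n)) *
          (z (Fin.last n) : ℂ) ^ (∑ j, p j - ∑ j, r j) := by
  set y : ℂ := (z (Fin.last n) : ℂ) with hy
  have hy0 : y ≠ 0 := (z _).ne_zero
  set x : Fin n → ℂ := fun i => (z i.castSucc : ℂ) with hx
  have hx0 : ∀ i, x i ≠ 0 := fun i => (z _).ne_zero
  -- Scaling column `j` by `y ^ (-p j)` turns the last row into `1, y, y², …`, which is then cleared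
  -- by subtracting `y` times each preceding column.
  set c : Fin (n + 1) → Fin (n + 1) → ℂ := fun i j => (z i : ℂ) ^ (p j + (j : ℤ)) * y ^ (-p j)
    with hc
  set M : Fin n → Fin n → ℂ := fun i j =>
    ∑ m ∈ Finset.Icc (p j.castSucc) (p j.succ), x i ^ (m + (j : ℤ)) * y ^ (-m) with hM
  -- The reduced entry is a telescoped geometric sum, and its range of summation is exactly the
  -- interlacing interval of the `j`-th entry.
  have tele : ∀ i j, (y - x i) * M i j = y * c i.castSucc j.castSucc - c i.castSucc j.succ := by
    intro i j
    have h1 := sum_Icc_int_telescope (fun m : ℤ => x i ^ (m + (j : ℤ)) * y ^ (1 - m))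
      (hp (Fin.castSucc_le_succ j))
    rw [hM, Finset.mul_sum]
    calc _ = ∑ m ∈ Finset.Icc (p j.castSucc) (p j.succ),
          (x i ^ (m + (j : ℤ)) * y ^ (1 - m) - x i ^ (m + 1 + (j : ℤ)) * y ^ (1 - (m + 1))) := by
          refine Finset.sum_congr rfl fun m _ => ?_
          have e1 : x i ^ (m + 1 + (j : ℤ)) = x i ^ (m + (j : ℤ)) * x i := by
            rw [← zpow_add_one₀ (hx0 i)]; congr 1; ring
          have e2 : y ^ (1 - m) = y ^ (-m) * y := by
            rw [← zpow_add_one₀ hy0]; congr 1; ring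
          have e3 : y ^ (1 - (m + 1)) = y ^ (-m) := by congr 1; ring
          rw [e1, e2, e3]; ring
      _ = _ := by
          rw [h1, hc]
          dsimp only
          have e2 : y ^ (1 - p j.castSucc) = y ^ (-p j.castSucc) * y := by
            rw [← zpow_add_one₀ hy0]; congr 1; ring
          have e3 : y ^ (1 - (p j.succ + 1)) = y ^ (-p j.succ) := by congr 1; ring
          have e4 : x i ^ (p j.succ + 1 + (j : ℤ)) =
              (z i.castSucc : ℂ) ^ (p j.succ + ((j.succ : Fin (n + 1)) : ℤ)) := by
            rw [hx]; congr 1; push_cast [Fin.val_succ]; ring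
          rw [e2, e3, e4]
          simp only [Fin.val_castSucc]
          rw [hx]; ring
  have hdetC : (Matrix.of c).det = ev z (alternant (p + delta (n + 1))) * y ^ (-∑ j, p j) := by
    rw [ev_alternant, ← Finset.sum_neg_distrib, mul_comm]
    rw [zpow_finset_sum hy0, ← Matrix.det_mul_row]
    congr 1
    ext i j
    simp [hc, delta, mul_comm]
  set B : Matrix (Fin (n + 1)) (Fin (n + 1)) ℂ := Matrix.of fun i =>
    Fin.cases (c i 0) fun j => c i j.succ - y * c i j.castSucc with hB
  have hdetB : (Matrix.of c).det = B.det := by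
    refine Matrix.det_eq_of_forall_col_eq_smul_add_pred (fun _ => y) (fun i => ?_) fun i j => ?_
    · simp [hB]
    · simp [hB]
  have hlast : ∀ j : Fin (n + 1), c (Fin.last n) j = y ^ (j : ℤ) := by
    intro j
    simp only [hc]
    rw [← hy, ← zpow_add₀ hy0]
    congr 1; ring
  have hBlast0 : B (Fin.last n) 0 = 1 := by
    have := hlast 0
    simpa [hB] using this
  have hBlast : ∀ j : Fin n, B (Fin.last n) j.succ = 0 := by
    intro j
    simp only [hB, Matrix.of_apply, Fin.cases_succ]
    rw [hlast, hlast]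
    simp only [Fin.val_succ, Fin.val_castSucc]
    push_cast
    rw [zpow_add_one₀ hy0]; ring
  have hdetB' : B.det = (∏ i, (y - x i)) * (Matrix.of M).det := by
    rw [Matrix.det_succ_row B (Fin.last n), Fin.sum_univ_succ]
    rw [Finset.sum_eq_zero (fun j _ => by rw [hBlast j]; ring), hBlast0, add_zero,
      ← Matrix.det_mul_column]
    have hsub : B.submatrix (Fin.last n).succAbove (Fin.succAbove 0) =
        -Matrix.of fun i j => (y - x i) * Matrix.of M i j := by
      ext i j
      simp only [Matrix.submatrix_apply, Fin.succAbove_last, Fin.succAbove_zero, hB,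
        Matrix.of_apply, Fin.cases_succ, Matrix.neg_apply, tele]
      ring
    -- The sign `(-1)^n` of the cofactor cancels the one from negating an `n × n` block.
    rw [hsub, Matrix.det_neg, Fintype.card_fin, mul_one, ← mul_assoc]
    simp only [Fin.val_last, Fin.val_zero, add_zero]
    rw [← mul_pow]; simp
  -- Multilinearity in the columns: choosing one summand per column is choosing an interlacing row
  -- `r`.
  have hdetM : (Matrix.of M).det = ∑ r ∈ interlacingRows p,
      ev (fun i => z i.castSucc) (alternant (r + delta n)) * y ^ (-∑ j, r j) := by
    rw [Matrix.det_apply']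
    simp only [Matrix.of_apply, hM]
    simp_rw [Finset.prod_univ_sum, Finset.mul_sum]
    rw [Finset.sum_comm]
    refine Finset.sum_congr rfl fun r _ => ?_
    rw [ev_alternant, Matrix.det_apply', Finset.sum_mul]
    refine Finset.sum_congr rfl fun σ _ => ?_
    rw [← Finset.sum_neg_distrib, zpow_finset_sum hy0, mul_assoc, ← Finset.prod_mul_distrib]
    rfl
  have hfin : ev z (alternant (p + delta (n + 1))) = (Matrix.of c).det * y ^ (∑ j, p j) := by
    rw [hdetC, mul_assoc, ← zpow_add₀ hy0]; simp
  rw [hfin, hdetB, hdetB', hdetM, mul_assoc, Finset.sum_mul]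
  congr 1
  refine Finset.sum_congr rfl fun r _ => ?_
  rw [mul_assoc, ← zpow_add₀ hy0]
  congr 2; ring

theorem interlacingRows_zero (n : ℕ) : interlacingRows (0 : Fin (n + 1) → ℤ) = {0} := by
  ext r
  rw [mem_interlacingRows, Finset.mem_singleton]
  constructor
  · intro h; funext j; exact le_antisymm (h j).2 (h j).1
  · rintro rfl j; simp

theorem ev_alternant_delta_succ {n : ℕ} (z : Fin (n + 1) → ℂˣ) :
    ev z (alternant (delta (n + 1))) =
      (∏ i : Fin n, ((z (Fin.last n) : ℂ) - z i.castSucc)) *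
        ev (fun i => z i.castSucc) (alternant (delta n)) := by
  have h := ev_alternant_succ (0 : Fin (n + 1) → ℤ) monotone_const z
  rw [interlacingRows_zero] at h
  simpa using h

/-- The Gelfand–Zetlin sum as a Laurent polynomial. -/
noncomputable def gzLaurent (ℓ : ℕ) (p : Fin (ℓ + 1) → ℤ) : Laurent (ℓ + 1) :=
  ∑ P ∈ (gzPatterns_finite ℓ p).toFinset,
    AddMonoidAlgebra.single (fun k : Fin (ℓ + 1) => rowSum P (k + 1) - rowSum P k) 1

theorem ev_gzLaurent (ℓ : ℕ) (p : Fin (ℓ + 1) → ℤ) (z : Fin (ℓ + 1) → ℂˣ) :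
    ev z (gzLaurent ℓ p) = ∑ P ∈ (gzPatterns_finite ℓ p).toFinset,
      ∏ k : Fin (ℓ + 1), (z k : ℂ) ^ (rowSum P (k + 1) - rowSum P k) := by
  simp only [gzLaurent, map_sum, ev_single, one_mul, torusChar_apply]

theorem gzChar_eq_ev {ℓ : ℕ} {p : Fin (ℓ + 1) → ℤ} (hp : Monotone p) (z : Fin (ℓ + 1) → ℂˣ) :
    gzChar ℓ p z = ev z (gzLaurent ℓ p) := by
  rw [ev_gzLaurent, gzChar, if_pos hp]

/-- Cut off the top row of a pattern. -/
def dropTop (ℓ : ℕ) (P : ℕ → ℕ → ℤ) : ℕ → ℕ → ℤ := fun k i => if k ≤ ℓ + 1 then P k i else 0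

/-- Put the row `p` on top of a pattern. -/
def addTop (ℓ : ℕ) (p : Fin (ℓ + 2) → ℤ) (P : ℕ → ℕ → ℤ) : ℕ → ℕ → ℤ := fun k i =>
  if k = ℓ + 2 then (if h : 1 ≤ i ∧ i ≤ ℓ + 2 then p ⟨i - 1, by omega⟩ else 0) else P k i

theorem rowSum_top {ℓ : ℕ} {p : Fin (ℓ + 1) → ℤ} {P : ℕ → ℕ → ℤ} (hP : P ∈ gzPatterns ℓ p) :
    rowSum P (ℓ + 1) = ∑ j, p j := by
  have h : Finset.Icc 1 (ℓ + 1) = (Finset.range (ℓ + 1)).image (· + 1) := by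
    ext i
    simp only [Finset.mem_Icc, Finset.mem_image, Finset.mem_range]
    exact ⟨fun hi => ⟨i - 1, by omega, by omega⟩, by rintro ⟨j, hj, rfl⟩; omega⟩
  rw [rowSum, h, Finset.sum_image (by intro a _ b _ hab; simpa using hab), Finset.sum_range]
  exact Finset.sum_congr rfl fun j _ => hP.1 j

theorem dropTop_mem {ℓ : ℕ} {p : Fin (ℓ + 2) → ℤ} {P : ℕ → ℕ → ℤ}
    (hP : P ∈ gzPatterns (ℓ + 1) p) :
    dropTop ℓ P ∈ gzPatterns ℓ fun j => P (ℓ + 1) (j + 1) := by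
  obtain ⟨h1, h2, h3⟩ := hP
  refine ⟨fun i => by simp [dropTop], fun k i hi hik hk => ?_, fun k i h => ?_⟩
  · have := h2 k i hi hik (by omega)
    simpa [dropTop, show k ≤ ℓ + 1 by omega, hk] using this
  · by_cases hk : k ≤ ℓ + 1
    · simp only [dropTop, hk, if_true]
      exact h3 k i (by omega)
    · simp [dropTop, hk]

theorem row_mem_interlacingRows {ℓ : ℕ} {p : Fin (ℓ + 2) → ℤ} {P : ℕ → ℕ → ℤ}
    (hP : P ∈ gzPatterns (ℓ + 1) p) :
    (fun j : Fin (ℓ + 1) => P (ℓ + 1) (j + 1)) ∈ interlacingRows p := by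
  obtain ⟨h1, h2, h3⟩ := hP
  rw [mem_interlacingRows]
  intro j
  have h := h2 (ℓ + 1) (j + 1) (by omega) (by omega) le_rfl
  have e1 := h1 j.castSucc
  have e2 := h1 j.succ
  simp only [Fin.val_castSucc, Fin.val_succ] at e1 e2
  rw [← e1, ← e2]
  exact h

theorem addTop_mem {ℓ : ℕ} {p : Fin (ℓ + 2) → ℤ} {r : Fin (ℓ + 1) → ℤ} {P : ℕ → ℕ → ℤ}
    (hr : r ∈ interlacingRows p) (hP : P ∈ gzPatterns ℓ r) :
    addTop ℓ p P ∈ gzPatterns (ℓ + 1) p := by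
  obtain ⟨h1, h2, h3⟩ := hP
  rw [mem_interlacingRows] at hr
  refine ⟨fun i => ?_, fun k i hi hik hk => ?_, fun k i h => ?_⟩
  · have : (i : ℕ) + 1 ≤ ℓ + 2 := i.2
    simp [addTop, this]
  · rcases Nat.lt_or_ge k (ℓ + 1) with hk' | hk'
    · simp only [addTop, show k ≠ ℓ + 2 by omega, show k + 1 ≠ ℓ + 2 by omega, if_false]
      exact h2 k i hi hik (by omega)
    · obtain rfl : k = ℓ + 1 := by omega
      have e := h1 ⟨i - 1, by omega⟩
      simp only [Nat.sub_add_cancel hi] at e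
      have := hr ⟨i - 1, by omega⟩
      simp only [addTop, show ℓ + 1 ≠ ℓ + 2 by omega, if_false, e]
      rw [if_pos trivial, dif_pos (by omega), dif_pos (by omega)]
      have e2 : (⟨i - 1, by omega⟩ : Fin (ℓ + 1)).succ = ⟨i + 1 - 1, by omega⟩ :=
        Fin.ext (by simp only [Fin.val_succ]; omega)
      rw [← e2]
      exact this
  · by_cases hk : k = ℓ + 2
    · subst hk
      simp only [addTop, if_true]
      rw [dif_neg (by omega)]
    · simp only [addTop, hk, if_false]
      exact h3 k i (by omega)

theorem addTop_dropTop {ℓ : ℕ} {p : Fin (ℓ + 2) → ℤ} {P : ℕ → ℕ → ℤ}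
    (hP : P ∈ gzPatterns (ℓ + 1) p) : addTop ℓ p (dropTop ℓ P) = P := by
  obtain ⟨h1, h2, h3⟩ := hP
  funext k i
  by_cases hk : k = ℓ + 2
  · subst hk
    by_cases hi : 1 ≤ i ∧ i ≤ ℓ + 2
    · have := h1 ⟨i - 1, by omega⟩
      simp only [Nat.sub_add_cancel hi.1] at this
      simp [addTop, hi, this]
    · simp only [addTop, if_true, hi, dif_neg, not_false_eq_true]
      exact (h3 _ _ (by omega)).symm
  · by_cases hk' : k ≤ ℓ + 1
    · simp [addTop, dropTop, hk, hk']
    · simp only [addTop, dropTop, hk, hk', if_false]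
      exact (h3 _ _ (by omega)).symm

theorem dropTop_addTop {ℓ : ℕ} {p : Fin (ℓ + 2) → ℤ} {r : Fin (ℓ + 1) → ℤ} {P : ℕ → ℕ → ℤ}
    (hP : P ∈ gzPatterns ℓ r) : dropTop ℓ (addTop ℓ p P) = P := by
  obtain ⟨h1, h2, h3⟩ := hP
  funext k i
  by_cases hk' : k ≤ ℓ + 1
  · simp [addTop, dropTop, hk', show k ≠ ℓ + 2 by omega]
  · simp only [dropTop, hk', if_false]
    exact (h3 _ _ (by omega)).symm

theorem rowSum_dropTop {ℓ k : ℕ} (P : ℕ → ℕ → ℤ) (hk : k ≤ ℓ + 1) :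
    rowSum (dropTop ℓ P) k = rowSum P k := by
  simp [rowSum, dropTop, hk]

/-- Branching of Gelfand–Zetlin sums. -/
theorem ev_gzLaurent_succ {ℓ : ℕ} (p : Fin (ℓ + 2) → ℤ) (z : Fin (ℓ + 2) → ℂˣ) :
    ev z (gzLaurent (ℓ + 1) p) = ∑ r ∈ interlacingRows p,
      ev (fun i => z i.castSucc) (gzLaurent ℓ r) *
        (z (Fin.last (ℓ + 1)) : ℂ) ^ (∑ j, p j - ∑ j, r j) := by
  simp only [ev_gzLaurent, Finset.sum_mul]
  rw [Finset.sum_sigma']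
  -- A pattern corresponds to its second row from the top together with the pattern below `p`.
  refine Finset.sum_bij' (fun P _ => ⟨fun j => P (ℓ + 1) (j + 1), dropTop ℓ P⟩)
    (fun x _ => addTop ℓ p x.2) ?_ ?_ ?_ ?_ ?_
  · intro P hP
    rw [Set.Finite.mem_toFinset] at hP
    simp only [Finset.mem_sigma, Set.Finite.mem_toFinset]
    exact ⟨row_mem_interlacingRows hP, dropTop_mem hP⟩
  · rintro ⟨r, P⟩ h
    simp only [Finset.mem_sigma, Set.Finite.mem_toFinset] at h ⊢
    exact addTop_mem h.1 h.2
  · intro P hP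
    rw [Set.Finite.mem_toFinset] at hP
    exact addTop_dropTop hP
  · rintro ⟨r, P⟩ h
    simp only [Finset.mem_sigma, Set.Finite.mem_toFinset] at h ⊢
    have e1 : (fun j : Fin (ℓ + 1) => addTop ℓ p P (ℓ + 1) (j + 1)) = r := by
      funext j
      simp [addTop, h.2.1 j]
    simp only [e1, dropTop_addTop h.2]
  · intro P hP
    rw [Set.Finite.mem_toFinset] at hP
    rw [Fin.prod_univ_castSucc]
    congr 1
    · refine Finset.prod_congr rfl fun k _ => ?_
      rw [rowSum_dropTop _ (by omega), rowSum_dropTop _ (by omega)]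
      rfl
    · rw [← rowSum_top hP, ← rowSum_top (dropTop_mem hP), rowSum_dropTop _ le_rfl]
      rfl

theorem ev_gzLaurent_zero (p : Fin 1 → ℤ) (z : Fin 1 → ℂˣ) :
    ev z (gzLaurent 0 p) = (z 0 : ℂ) ^ p 0 := by
  have h : (gzPatterns_finite 0 p).toFinset = {fun k i => if k = 1 ∧ i = 1 then p 0 else 0} := by
    ext P
    rw [Set.Finite.mem_toFinset, Finset.mem_singleton]
    constructor
    · rintro ⟨h1, -, h3⟩
      funext k i
      by_cases h : k = 1 ∧ i = 1
      · obtain ⟨rfl, rfl⟩ := h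
        simpa using h1 0
      · rw [if_neg h]
        exact h3 _ _ (by omega)
    · rintro rfl
      refine ⟨fun i => ?_, fun k i _ _ _ => by omega, fun k i h => if_neg (by omega)⟩
      have : i = 0 := Fin.fin_one_eq_zero i
      subst this
      simp
  rw [ev_gzLaurent, h]
  simp [rowSum]

/-- Both branching rules sum over the same interlacing rows with the same power of the last
variable. The extra product in the rule for alternants is the quotient of consecutive Vandermonde
determinants, so induction applies row by row. -/
theorem ev_alternant_mul_gzLaurent (ℓ : ℕ) (p : Fin (ℓ + 1) → ℤ) (hp : Monotone p)
    (z : Fin (ℓ + 1) → ℂˣ) :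
    ev z (alternant (delta (ℓ + 1))) * ev z (gzLaurent ℓ p) =
      ev z (alternant (p + delta (ℓ + 1))) := by
  induction ℓ with
  | zero =>
    rw [ev_gzLaurent_zero, ev_alternant, ev_alternant]
    simp [delta]
  | succ ℓ ih =>
    rw [ev_alternant_succ p hp, ev_gzLaurent_succ, ev_alternant_delta_succ, mul_assoc,
      Finset.mul_sum]
    congr 1
    refine Finset.sum_congr rfl fun r hr => ?_
    rw [← mul_assoc, ih r (monotone_of_mem_interlacingRows hr)]

/-- The Gelfand–Zetlin sum is a quotient of alternants. -/
theorem alternant_mul_gzLaurent (ℓ : ℕ) (p : Fin (ℓ + 1) → ℤ) (hp : Monotone p) :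
    alternant (delta (ℓ + 1)) * gzLaurent ℓ p = alternant (p + delta (ℓ + 1)) :=
  ev_ext fun z => by rw [map_mul, ev_alternant_mul_gzLaurent ℓ p hp z]

/-! ### The limit `q → 0` -/

theorem tendsto_qFactorial (n : ℤ) :
    Tendsto (fun q => qFactorial q n) (𝓝[>] (0 : ℝ)) (𝓝 1) := by
  have hc : Continuous fun q => qFactorial q n := by unfold qFactorial; fun_prop
  have h0 : qFactorial 0 n = 1 := by
    refine Finset.prod_eq_one fun j hj => ?_
    rw [zero_pow (by have := (Finset.mem_Icc.mp hj).1; omega), sub_zero]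
  have h1 := hc.tendsto 0
  rw [h0] at h1
  exact h1.mono_left nhdsWithin_le_nhds

theorem tendsto_qWeight (ℓ : ℕ) (P : ℕ → ℕ → ℤ) :
    Tendsto (fun q => qWeight ℓ q P) (𝓝[>] (0 : ℝ)) (𝓝 1) := by
  have h1 : Tendsto (fun q : ℝ => ∏ k ∈ Finset.Icc 2 ℓ, ∏ i ∈ Finset.Icc 1 (k - 1),
      qFactorial q (P k (i + 1) - P k i)) (𝓝[>] (0 : ℝ))
      (𝓝 (∏ k ∈ Finset.Icc 2 ℓ, ∏ i ∈ Finset.Icc 1 (k - 1), 1)) :=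
    tendsto_finsetProd _ fun k _ => tendsto_finsetProd _ fun i _ => tendsto_qFactorial _
  have h2 : Tendsto (fun q : ℝ => ∏ k ∈ Finset.Icc 1 ℓ, ∏ i ∈ Finset.Icc 1 k,
      (qFactorial q (P k i - P (k + 1) i) * qFactorial q (P (k + 1) (i + 1) - P k i)))
      (𝓝[>] (0 : ℝ)) (𝓝 (∏ k ∈ Finset.Icc 1 ℓ, ∏ i ∈ Finset.Icc 1 k, (1 * 1))) :=
    tendsto_finsetProd _ fun k _ => tendsto_finsetProd _ fun i _ =>
      (tendsto_qFactorial _).mul (tendsto_qFactorial _)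
  have h3 := h1.div h2 (by simp)
  simp only [Finset.prod_const_one, mul_one, div_one] at h3
  exact h3

theorem tendsto_qWhittakerFun {ℓ : ℕ} {p : Fin (ℓ + 1) → ℤ} (hp : Monotone p)
    (z : Fin (ℓ + 1) → ℂˣ) (lam : ℝ → Fin (ℓ + 1) → ℂ)
    (h : ∀ᶠ q : ℝ in 𝓝[>] (0 : ℝ), ∀ i, (q : ℂ) ^ lam q i = z i) :
    Tendsto (fun q : ℝ => qWhittakerFun ℓ q (lam q) p) (𝓝[>] (0 : ℝ)) (𝓝 (gzChar ℓ p z)) := by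
  simp only [qWhittakerFun, gzChar, if_pos hp]
  refine tendsto_finsetSum _ fun P _ => ?_
  have h1 : Tendsto (fun q : ℝ => (∏ k : Fin (ℓ + 1),
      (z k : ℂ) ^ (rowSum P (k + 1) - rowSum P k)) * (qWeight ℓ q P : ℂ)) (𝓝[>] (0 : ℝ))
      (𝓝 ((∏ k : Fin (ℓ + 1), (z k : ℂ) ^ (rowSum P (k + 1) - rowSum P k)) * ((1 : ℝ) : ℂ))) :=
    tendsto_const_nhds.mul ((Complex.continuous_ofReal.tendsto 1).comp (tendsto_qWeight ℓ P))
  rw [Complex.ofReal_one, mul_one] at h1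
  refine h1.congr' ?_
  filter_upwards [h] with q hq
  congr 1
  refine Finset.prod_congr rfl fun k _ => ?_
  -- The exponent multiplying `λ` is an integer, so no branch of the logarithm interferes.
  rw [Complex.cpow_mul_int, hq k]

/-! ### The Pieri rule -/

/-- Wedges of standard basis vectors form an eigenbasis, the one indexed by `s` having eigenvalue `∏
i ∈ s, z i`. -/
theorem fundChar_eq {n : ℕ} (r : ℕ) (z : Fin n → ℂˣ) :
    fundChar r z = ∑ I ∈ Finset.powersetCard r (Finset.univ : Finset (Fin n)),
      ∏ i ∈ I, (z i : ℂ) := by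
  classical
  set b := Pi.basisFun ℂ (Fin n) with hb
  set f := Matrix.toLin' (Matrix.diagonal fun i => (z i : ℂ)) with hf
  have hfb : ∀ i, f (b i) = (z i : ℂ) • b i := by
    intro i
    rw [hf, hb, Pi.basisFun_apply, Matrix.toLin'_apply]
    ext j
    simp only [Matrix.mulVec_diagonal, Pi.smul_apply, smul_eq_mul]
    by_cases h : j = i
    · subst h; rfl
    · simp [h]
  have hdiag : ∀ s : Set.powersetCard (Fin n) r,
      exteriorPower.map r f (exteriorPower.ιMulti_family ℂ r b s) =
        (∏ i ∈ (s : Finset (Fin n)), (z i : ℂ)) • exteriorPower.ιMulti_family ℂ r b s := by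
    intro s
    rw [exteriorPower.map_apply_ιMulti_family, exteriorPower.ιMulti_family,
      exteriorPower.ιMulti_family]
    have h1 : (f ∘ b) ∘ ⇑(Set.powersetCard.ofFinEmbEquiv.symm s) =
        fun k => (z (Set.powersetCard.ofFinEmbEquiv.symm s k) : ℂ) •
          (b ∘ ⇑(Set.powersetCard.ofFinEmbEquiv.symm s)) k := by
      funext k
      simp [hfb]
    rw [h1, AlternatingMap.map_smul_univ]
    congr 1
    have h2 := Finset.map_orderEmbOfFin_univ (s : Finset (Fin n)) (Set.powersetCard.card_eq s)
    conv_rhs => rw [← h2]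
    rw [Finset.prod_map]
    rfl
  rw [fundChar, LinearMap.trace_eq_matrix_trace ℂ (b.exteriorPower r), Matrix.trace]
  simp only [Matrix.diag_apply, LinearMap.toMatrix_apply]
  have h3 : ∀ s : Set.powersetCard (Fin n) r,
      ((b.exteriorPower r).repr (exteriorPower.map r f (b.exteriorPower r s))) s =
        ∏ i ∈ (s : Finset (Fin n)), (z i : ℂ) := by
    intro s
    rw [exteriorPower.basis_apply, hdiag, map_smul, exteriorPower.basis_repr]
    simp
  rw [Finset.sum_congr rfl fun s _ => h3 s]
  refine Finset.sum_bij (fun s _ => (s : Finset (Fin n))) ?_ ?_ ?_ ?_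
  · intro s _
    exact Finset.mem_powersetCard.mpr ⟨Finset.subset_univ _, (Set.powersetCard.card_eq s)⟩
  · intro s _ t _ h
    exact Subtype.ext h
  · intro I hI
    exact ⟨⟨I, (Finset.mem_powersetCard.mp hI).2⟩, Finset.mem_univ _, rfl⟩
  · intro s _
    rfl

/-- The elementary symmetric Laurent polynomial. -/
noncomputable def esymmLaurent (n r : ℕ) : Laurent n :=
  ∑ I ∈ Finset.powersetCard r (Finset.univ : Finset (Fin n)), ∏ i ∈ I, lvar i

theorem ev_esymmLaurent {n : ℕ} (r : ℕ) (z : Fin n → ℂˣ) :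
    ev z (esymmLaurent n r) = fundChar r z := by
  simp [esymmLaurent, fundChar_eq, ev_lvar]

theorem esymm_comp_perm {n : ℕ} (r : ℕ) (σ : Equiv.Perm (Fin n)) (z : Fin n → ℂ) :
    ∑ I ∈ Finset.powersetCard r (Finset.univ : Finset (Fin n)), ∏ i ∈ I, z (σ i) =
      ∑ I ∈ Finset.powersetCard r (Finset.univ : Finset (Fin n)), ∏ i ∈ I, z i := by
  have h : Finset.powersetCard r (Finset.univ : Finset (Fin n)) =
      (Finset.powersetCard r Finset.univ).map (Finset.mapEmbedding σ.toEmbedding).toEmbedding := by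
    rw [← Finset.powersetCard_map]; simp
  conv_rhs => rw [h]
  rw [Finset.sum_map]
  refine Finset.sum_congr rfl fun I _ => ?_
  simp

/-- In the Leibniz term of `σ`, the symmetric polynomial may be written in the variables `z (σ i)`.
Its monomial for `I` then raises exactly the exponents of the columns in `I`. -/
theorem esymmLaurent_mul_alternant {n : ℕ} (r : ℕ) (ν : Fin n → ℤ) :
    esymmLaurent n r * alternant ν =
      ∑ I ∈ Finset.powersetCard r (Finset.univ : Finset (Fin n)), alternant (shift ν I) := by
  refine ev_ext fun z => ?_
  rw [map_mul, ev_esymmLaurent, fundChar_eq, map_sum]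
  simp only [ev_alternant, Matrix.det_apply', Finset.mul_sum, Matrix.of_apply]
  rw [Finset.sum_comm]
  refine Finset.sum_congr rfl fun σ _ => ?_
  rw [← esymm_comp_perm r σ fun i => (z i : ℂ), Finset.sum_mul]
  refine Finset.sum_congr rfl fun I _ => ?_
  rw [mul_left_comm]
  congr 1
  have h1 : ∏ i ∈ I, (z (σ i) : ℂ) = ∏ i, if i ∈ I then (z (σ i) : ℂ) else 1 := by
    rw [Finset.prod_ite_mem, Finset.univ_inter]
  rw [h1, ← Finset.prod_mul_distrib]
  refine Finset.prod_congr rfl fun i _ => ?_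
  rw [shift]
  split_ifs
  · rw [zpow_add_one₀ (z (σ i)).ne_zero, mul_comm]
  · rw [one_mul, add_zero]

theorem shift_add {n : ℕ} (p ν : Fin n → ℤ) (I : Finset (Fin n)) :
    shift (p + ν) I = shift p I + ν := by
  funext i
  simp only [shift, Pi.add_apply]
  ring

theorem alternant_eq_zero_of_eq {n : ℕ} {ν : Fin n → ℤ} {i j : Fin n} (hij : i ≠ j)
    (h : ν i = ν j) : alternant ν = 0 :=
  Matrix.det_zero_of_column_eq hij fun k => by simp [h]

/-- Adding 0 or 1 to each entry can break monotonicity only where `p_i = p_{i+1}` with `i ∈ I`, `i +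
1 ∉ I`. Adding `δ` then makes these two exponents equal. -/
theorem alternant_shift_of_not_monotone {n : ℕ} {p : Fin n → ℤ} (hp : Monotone p)
    {I : Finset (Fin n)} (h : ¬ Monotone (shift p I)) :
    alternant (shift p I + delta n) = 0 := by
  cases n with
  | zero => exact absurd (fun i => i.elim0) h
  | succ n =>
    rw [Fin.monotone_iff_le_succ] at h
    push Not at h
    obtain ⟨i, hi⟩ := h
    have h1 := hp (Fin.castSucc_le_succ i)
    refine alternant_eq_zero_of_eq (i := i.castSucc) (j := i.succ) Fin.castSucc_lt_succ.ne ?_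
    simp only [shift, delta, Pi.add_apply, Fin.val_succ, Fin.val_castSucc] at hi ⊢
    push_cast
    split_ifs at hi ⊢ <;> omega

theorem fundChar_mul_gzChar {ℓ : ℕ} {p : Fin (ℓ + 1) → ℤ} (hp : Monotone p) (r : ℕ)
    (z : Fin (ℓ + 1) → ℂˣ) :
    fundChar r z * gzChar ℓ p z =
      ∑ I ∈ Finset.powersetCard r (Finset.univ : Finset (Fin (ℓ + 1))),
        gzChar ℓ (shift p I) z := by
  classical
  have key : esymmLaurent (ℓ + 1) r * gzLaurent ℓ p =
      ∑ I ∈ Finset.powersetCard r (Finset.univ : Finset (Fin (ℓ + 1))),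
        if Monotone (shift p I) then gzLaurent ℓ (shift p I) else 0 := by
    -- Cancellation takes place among Laurent polynomials, because the Vandermonde determinant
    -- vanishes at points with repeated coordinates.
    refine mul_left_cancel₀ (alternant_delta_ne_zero (ℓ + 1)) ?_
    rw [mul_left_comm, alternant_mul_gzLaurent ℓ p hp, esymmLaurent_mul_alternant, Finset.mul_sum]
    refine Finset.sum_congr rfl fun I _ => ?_
    rw [shift_add]
    split_ifs with h
    · rw [alternant_mul_gzLaurent ℓ _ h]
    · rw [alternant_shift_of_not_monotone hp h, mul_zero]
  have h := congrArg (ev z) key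
  rw [map_mul, ev_esymmLaurent, ← gzChar_eq_ev hp, map_sum] at h
  rw [h]
  refine Finset.sum_congr rfl fun I _ => ?_
  split_ifs with hI
  · rw [gzChar_eq_ev hI]
  · rw [gzChar, if_neg hI, map_zero]

/-! ### The differential of a rational representation -/

section Differential

variable {n : ℕ} {V : Type*} [AddCommGroup V] [Module ℂ V]
  {ρ : Representation ℂ (Matrix.GeneralLinearGroup (Fin n) ℂ) V}

theorem differentiable_eval_mvPolynomial (Q : MvPolynomial (Fin n × Fin n) ℂ) :
    Differentiable ℂ fun M : Fin n → Fin n → ℂ => MvPolynomial.eval (fun ij => M ij.1 ij.2) Q := by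
  induction Q using MvPolynomial.induction_on with
  | C a => simp
  | add p q hp hq =>
    simp only [map_add]
    exact hp.fun_add hq
  | mul_X p ij hp =>
    simp only [map_mul, MvPolynomial.eval_X]
    exact hp.fun_mul (by fun_prop)

/-- The quotient defining the coefficient makes sense for all matrices, so ordinary calculus on a
vector space applies. The denominator is 1 at the identity. -/
theorem exists_differentiable_coeff (hρ : IsRational ρ) (f : Module.Dual ℂ V) (v : V) :
    ∃ F : (Fin n → Fin n → ℂ) → ℂ,
      DifferentiableAt ℂ F (fun i j => (1 : Matrix (Fin n) (Fin n) ℂ) i j) ∧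
      ∀ g : Matrix.GeneralLinearGroup (Fin n) ℂ,
        f (ρ g v) = F fun i j => (g : Matrix (Fin n) (Fin n) ℂ) i j := by
  obtain ⟨Q, N, hQ⟩ := hρ f v
  have hdet : ∀ M : Fin n → Fin n → ℂ, MvPolynomial.eval (fun ij : Fin n × Fin n => M ij.1 ij.2)
      (Matrix.mvPolynomialX (Fin n) (Fin n) ℂ).det = (Matrix.of M).det := by
    intro M
    rw [RingHom.map_det]
    exact congrArg Matrix.det (Matrix.mvPolynomialX_mapMatrix_eval (Matrix.of M))
  refine ⟨fun M => MvPolynomial.eval (fun ij => M ij.1 ij.2) Q /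
    (MvPolynomial.eval (fun ij => M ij.1 ij.2) (Matrix.mvPolynomialX (Fin n) (Fin n) ℂ).det) ^ N,
    ?_, fun g => ?_⟩
  · have h1 := differentiable_eval_mvPolynomial Q fun i j => (1 : Matrix (Fin n) (Fin n) ℂ) i j
    have h2 := (differentiable_eval_mvPolynomial (Matrix.mvPolynomialX (Fin n) (Fin n) ℂ).det
      fun i j => (1 : Matrix (Fin n) (Fin n) ℂ) i j).fun_pow N
    simp only [div_eq_mul_inv]
    refine h1.fun_mul (h2.inv ?_)
    refine pow_ne_zero _ ?_
    have h3 : MvPolynomial.eval (fun ij : Fin n × Fin n => (1 : Matrix (Fin n) (Fin n) ℂ) ij.1 ij.2)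
        (Matrix.mvPolynomialX (Fin n) (Fin n) ℂ).det = 1 :=
      (hdet fun i j => (1 : Matrix (Fin n) (Fin n) ℂ) i j).trans Matrix.det_one
    exact h3 ▸ one_ne_zero
  · dsimp only
    rw [hQ g, hdet fun i j => (g : Matrix (Fin n) (Fin n) ℂ) i j]; rfl

variable (ρ) in
/-- `E` is the differential of the representation `ρ` at the identity. -/
def IsDifferential (E : Matrix (Fin n) (Fin n) ℂ →ₗ[ℂ] Module.End ℂ V) : Prop :=
  ∀ (g : ℂ → Matrix.GeneralLinearGroup (Fin n) ℂ) (A : Matrix (Fin n) (Fin n) ℂ), g 0 = 1 →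
    (∀ i j, HasDerivAt (fun t => (g t : Matrix (Fin n) (Fin n) ℂ) i j) (A i j) 0) →
    ∀ (f : Module.Dual ℂ V) (v : V), HasDerivAt (fun t => f (ρ (g t) v)) (f (E A v)) 0

/-- The matrix entries of `E` are the Fréchet derivatives at the identity of the matrix coefficients
in a basis. Linearity in `A` is that of the derivative, and the property along curves is the chain
rule. -/
theorem exists_isDifferential [FiniteDimensional ℂ V] (hρ : IsRational ρ) :
    ∃ E : Matrix (Fin n) (Fin n) ℂ →ₗ[ℂ] Module.End ℂ V, IsDifferential ρ E := by
  classical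
  set b := Module.finBasis ℂ V
  choose F hF hFg using fun a c => exists_differentiable_coeff hρ (b.coord a) (b c)
  set L := fun a c => fderiv ℂ (F a c) (fun i j => (1 : Matrix (Fin n) (Fin n) ℂ) i j) with hL
  refine ⟨{ toFun := fun A => Matrix.toLin b b (Matrix.of fun a c => L a c fun i j => A i j)
            map_add' := fun A B => ?_
            map_smul' := fun s A => ?_ }, ?_⟩
  · rw [← map_add]
    congr 1
    ext a c
    exact map_add (L a c) (fun i j => A i j) fun i j => B i j
  · rw [RingHom.id_apply, ← map_smul]
    congr 1
    ext a c
    exact map_smul (L a c) s fun i j => A i j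
  · intro g A hg hd f v
    have hG : HasDerivAt (fun t => fun i j => (g t : Matrix (Fin n) (Fin n) ℂ) i j)
        (fun i j => A i j) 0 := by
      rw [hasDerivAt_pi]
      intro i
      rw [hasDerivAt_pi]
      exact hd i
    have hentry : ∀ a c, HasDerivAt (fun t => b.coord a (ρ (g t) (b c)))
        (L a c fun i j => A i j) 0 := by
      intro a c
      simp only [hFg]
      have h1 : HasFDerivAt (F a c) (L a c) (fun i j => (g 0 : Matrix (Fin n) (Fin n) ℂ) i j) := by
        rw [hg]; exact (hF a c).hasFDerivAt
      exact h1.comp_hasDerivAt (0 : ℂ) hG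
    have hexp : ∀ T : Module.End ℂ V, f (T v) =
        ∑ c, b.repr v c * ∑ a, b.coord a (T (b c)) * f (b a) := by
      intro T
      conv_lhs => rw [← b.sum_repr v]
      simp only [map_sum, map_smul, smul_eq_mul]
      refine Finset.sum_congr rfl fun c _ => ?_
      congr 1
      conv_lhs => rw [← b.sum_repr (T (b c))]
      simp only [map_sum, map_smul, smul_eq_mul, Module.Basis.coord_apply]
    rw [show (fun t => f (ρ (g t) v)) = _ from funext fun t => hexp (ρ (g t)), hexp]
    refine HasDerivAt.fun_sum fun c _ => HasDerivAt.const_mul _ (HasDerivAt.fun_sum fun a _ => ?_)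
    refine HasDerivAt.mul_const ?_ _
    have hval : b.coord a (Matrix.toLin b b (Matrix.of fun a c => L a c fun i j => A i j) (b c)) =
        L a c fun i j => A i j := by
      rw [Matrix.toLin_self, map_sum, Finset.sum_eq_single a]
      · simp
      · intro b' _ hb'
        simp [hb']
      · simp
    have h1 := hentry a c
    rw [← hval] at h1
    exact h1

/-- The elementary matrix `1 + t E_{ij}`, `i ≠ j`, as an element of `GL_n`. -/
noncomputable def elemGL {i j : Fin n} (hij : i ≠ j) (t : ℂ) :
    Matrix.GeneralLinearGroup (Fin n) ℂ where
  val := Matrix.transvection i j t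
  inv := Matrix.transvection i j (-t)
  val_inv := by rw [Matrix.transvection_mul_transvection_same _ _ hij]; simp
  inv_val := by rw [Matrix.transvection_mul_transvection_same _ _ hij]; simp

theorem coe_elemGL {i j : Fin n} (hij : i ≠ j) (t : ℂ) :
    (elemGL hij t : Matrix (Fin n) (Fin n) ℂ) = 1 + Matrix.single i j t := rfl

theorem coe_inv_elemGL {i j : Fin n} (hij : i ≠ j) (t : ℂ) :
    ((elemGL hij t)⁻¹ : Matrix.GeneralLinearGroup (Fin n) ℂ).val = 1 + Matrix.single i j (-t) := rfl

theorem elemGL_zero {i j : Fin n} (hij : i ≠ j) : elemGL hij 0 = 1 := by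
  ext; simp [coe_elemGL]

theorem elemGL_add {i j : Fin n} (hij : i ≠ j) (s t : ℂ) :
    elemGL hij (s + t) = elemGL hij s * elemGL hij t :=
  Units.ext (Matrix.transvection_mul_transvection_same i j hij s t).symm

theorem coe_torusElt (z : Fin n → ℂˣ) :
    (torusElt z : Matrix (Fin n) (Fin n) ℂ) = Matrix.diagonal fun i => (z i : ℂ) := rfl

theorem torusElt_mul (y z : Fin n → ℂˣ) : torusElt (y * z) = torusElt y * torusElt z := by
  apply Units.ext
  change Matrix.diagonal _ = Matrix.diagonal _ * Matrix.diagonal _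
  rw [Matrix.diagonal_mul_diagonal]
  rfl

theorem torusElt_one : torusElt (1 : Fin n → ℂˣ) = 1 := by
  apply Units.ext
  change Matrix.diagonal _ = 1
  simp

/-- The one-parameter subgroup `t ↦ diag(1, …, exp t, …, 1)`. -/
noncomputable def expTorus (i : Fin n) (t : ℂ) : Fin n → ℂˣ :=
  Pi.mulSingle i (Units.mk0 (Complex.exp t) (Complex.exp_ne_zero t))

theorem hasDerivAt_elemGL {i j : Fin n} (hij : i ≠ j) (k l : Fin n) :
    HasDerivAt (fun t => (elemGL hij t : Matrix (Fin n) (Fin n) ℂ) k l)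
      (Matrix.single i j (1 : ℂ) k l) 0 := by
  simp only [coe_elemGL, Matrix.add_apply]
  refine HasDerivAt.const_add _ ?_
  simp only [Matrix.single_apply]
  split_ifs
  · exact hasDerivAt_id _
  · exact hasDerivAt_const _ _

theorem hasDerivAt_expTorus (i k l : Fin n) :
    HasDerivAt (fun t => (torusElt (expTorus i t) : Matrix (Fin n) (Fin n) ℂ) k l)
      (Matrix.single i i (1 : ℂ) k l) 0 := by
  simp only [coe_torusElt, Matrix.diagonal_apply, Matrix.single_apply]
  by_cases hkl : k = l
  · subst hkl
    by_cases hik : k = i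
    · subst hik
      simp only [expTorus, Pi.mulSingle_eq_same, Units.val_mk0, if_true, and_self]
      simpa using Complex.hasDerivAt_exp 0
    · simp only [expTorus, Pi.mulSingle_eq_of_ne hik, Ne.symm hik, if_true, false_and, if_false]
      exact hasDerivAt_const _ _
  · have : ¬ (i = k ∧ i = l) := fun h => hkl (h.1 ▸ h.2)
    simp only [hkl, this, if_false]
    exact hasDerivAt_const _ _

theorem expTorus_zero (i : Fin n) : expTorus i 0 = 1 := by
  simp [expTorus, Units.mk0_one]

/-- On the diagonal `1 + t E_ii` is not invertible at `t = -1`, so an exponential curve replaces it.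
-/
theorem exists_curve (i j : Fin n) : ∃ g : ℂ → Matrix.GeneralLinearGroup (Fin n) ℂ, g 0 = 1 ∧
    ∀ k l, HasDerivAt (fun t => (g t : Matrix (Fin n) (Fin n) ℂ) k l)
      (Matrix.single i j (1 : ℂ) k l) 0 := by
  by_cases hij : i = j
  · subst hij
    exact ⟨fun t => torusElt (expTorus i t), by simp only [expTorus_zero, torusElt_one],
      hasDerivAt_expTorus i⟩
  · exact ⟨elemGL hij, elemGL_zero hij, hasDerivAt_elemGL hij⟩

variable {E : Matrix (Fin n) (Fin n) ℂ →ₗ[ℂ] Module.End ℂ V}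

theorem eq_of_forall_dual {x y : V} (h : ∀ f : Module.Dual ℂ V, f x = f y) : x = y := by
  rw [← sub_eq_zero, ← Module.forall_dual_apply_eq_zero_iff ℂ]
  intro f; rw [map_sub, h, sub_self]

/-- Equivariance of the differential under the adjoint action. -/
theorem IsDifferential.conj (hE : IsDifferential ρ E) (h : Matrix.GeneralLinearGroup (Fin n) ℂ)
    (A : Matrix (Fin n) (Fin n) ℂ) (v : V) :
    ρ h (E A v) = E (h.val * A * h⁻¹.val) (ρ h v) := by
  have hsingle : ∀ i j, ρ h (E (Matrix.single i j 1) v) =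
      E (h.val * Matrix.single i j 1 * h⁻¹.val) (ρ h v) := by
    intro i j
    obtain ⟨g, hg0, hg⟩ := exists_curve i j
    refine eq_of_forall_dual fun f => ?_
    have h1 := hE g _ hg0 hg (f ∘ₗ ρ h) v
    have h2 := hE (fun t => h * g t * h⁻¹) (h.val * Matrix.single i j 1 * h⁻¹.val)
      (by rw [hg0]; group) (by
        intro k l
        have : ∀ M : Matrix (Fin n) (Fin n) ℂ, (h.val * M * h⁻¹.val) k l =
            ∑ b, (∑ a, h.val k a * M a b) * h⁻¹.val b l := fun M => by
          simp only [Matrix.mul_apply]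
        simp only [Units.val_mul, this]
        refine HasDerivAt.fun_sum fun b _ => HasDerivAt.mul_const (HasDerivAt.fun_sum fun a _ =>
          HasDerivAt.const_mul _ (hg a b)) _) f (ρ h v)
    have h3 : (fun t => f (ρ (h * g t * h⁻¹) (ρ h v))) = fun t => (f ∘ₗ ρ h) (ρ (g t) v) := by
      funext t
      have : ρ (h * g t * h⁻¹) (ρ h v) = ρ h (ρ (g t) v) := by
        rw [← Module.End.mul_apply, ← Module.End.mul_apply, ← map_mul, ← map_mul]
        congr 2; group
      rw [this]; rfl
    rw [h3] at h2
    exact h1.unique h2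
  rw [Matrix.matrix_eq_sum_single A]
  simp only [map_sum, Finset.mul_sum, Finset.sum_mul, LinearMap.sum_apply]
  refine Finset.sum_congr rfl fun i _ => Finset.sum_congr rfl fun j _ => ?_
  have hs : Matrix.single i j (A i j) = A i j • Matrix.single i j (1 : ℂ) := by
    rw [Matrix.smul_single, smul_eq_mul, mul_one]
  rw [hs, map_smul, LinearMap.smul_apply, map_smul, hsingle, Matrix.mul_smul, Matrix.smul_mul,
    map_smul, LinearMap.smul_apply]

/-- The differential respects brackets with off-diagonal matrix units. -/
theorem IsDifferential.bracket (hE : IsDifferential ρ E) {i j : Fin n} (hij : i ≠ j)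
    (A : Matrix (Fin n) (Fin n) ℂ) (v : V) :
    E (Matrix.single i j 1) (E A v) = E A (E (Matrix.single i j 1) v) +
      E (Matrix.single i j 1 * A - A * Matrix.single i j 1) v := by
  set B : Matrix (Fin n) (Fin n) ℂ := Matrix.single i j 1 with hB
  refine eq_of_forall_dual fun f => ?_
  have hx := fun f v => hE (elemGL hij) B (elemGL_zero hij) (hasDerivAt_elemGL hij) f v
  have h1 := hx f (E A v)
  have h2 := ((hx (f ∘ₗ E A) v).add ((hasDerivAt_id (0 : ℂ)).mul
    (hx (f ∘ₗ E (B * A - A * B)) v))).add (((hasDerivAt_id (0 : ℂ)).mul (hasDerivAt_id 0)).mul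
    (hx (f ∘ₗ E (-(B * A * B))) v))
  -- Since `(1 + tB)⁻¹ = 1 - tB`, conjugating `A` gives exactly `A + t[B, A] - t² BAB`.
  -- Differentiating the equivariance at `t = 0` leaves the bracket.
  have h3 : (fun t => f (ρ (elemGL hij t) (E A v))) = fun t =>
      (f ∘ₗ E A) (ρ (elemGL hij t) v) + id t * (f ∘ₗ E (B * A - A * B)) (ρ (elemGL hij t) v) +
      id t * id t * (f ∘ₗ E (-(B * A * B))) (ρ (elemGL hij t) v) := by
    funext t
    rw [hE.conj, coe_elemGL, coe_inv_elemGL]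
    have e1 : Matrix.single i j t = t • B := by rw [hB, Matrix.smul_single, smul_eq_mul, mul_one]
    have e2 : Matrix.single i j (-t) = -(t • B) := by rw [← e1, Matrix.single_neg]
    have e3 : (1 + Matrix.single i j t) * A * (1 + Matrix.single i j (-t)) =
        A + t • (B * A - A * B) + (t * t) • (-(B * A * B)) := by
      rw [e1, e2]
      simp only [add_mul, mul_add, mul_neg, one_mul, mul_one, Matrix.smul_mul, Matrix.mul_smul,
        smul_sub, smul_neg, smul_smul]
      abel
    rw [e3]
    simp
  rw [h3] at h1
  have h4 := h1.unique h2
  simpa [elemGL_zero] using h4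

end Differential

/-! ### Weights -/

section Weights

variable {n : ℕ} {V : Type*} [AddCommGroup V] [Module ℂ V]
  {ρ : Representation ℂ (Matrix.GeneralLinearGroup (Fin n) ℂ) V}

/-- On diagonal matrices the entries are variables or zero, and the inverse power of the determinant
is a Laurent monomial. -/
theorem exists_laurent_coeff (hρ : IsRational ρ) (f : Module.Dual ℂ V) (v : V) :
    ∃ l : Laurent n, ∀ z, f (ρ (torusElt z) v) = ev z l := by
  obtain ⟨Q, N, hQ⟩ := hρ f v
  refine ⟨MvPolynomial.aeval (fun ij : Fin n × Fin n => if ij.1 = ij.2 then lvar ij.1 else 0) Q *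
    AddMonoidAlgebra.single (fun _ => -(N : ℤ)) 1, fun z => ?_⟩
  rw [hQ, map_mul, ev_single, one_mul, div_eq_mul_inv]
  congr 1
  · rw [← AlgHom.comp_apply, MvPolynomial.comp_aeval, ← MvPolynomial.coe_aeval_eq_eval]
    have : (fun ij : Fin n × Fin n => (torusElt z : Matrix (Fin n) (Fin n) ℂ) ij.1 ij.2) =
        fun ij => ev z (if ij.1 = ij.2 then lvar ij.1 else 0) := by
      funext ij
      rw [coe_torusElt, Matrix.diagonal_apply]
      split_ifs
      · rw [ev_lvar]
      · rw [map_zero]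
    rw [this]
    rfl
  · rw [coe_torusElt, Matrix.det_diagonal, torusChar_apply, ← Finset.prod_pow, ← Finset.prod_inv_distrib]
    exact Finset.prod_congr rfl fun i _ => by rw [zpow_neg, zpow_natCast]

variable (ρ) in
/-- `P` is the family of projections to the weight spaces of `ρ`. -/
def IsWeightDecomposition (P : (Fin n → ℤ) →₀ Module.End ℂ V) : Prop :=
  ∀ z, ρ (torusElt z) = P.sum fun μ T => torusChar μ z • T

theorem exists_isWeightDecomposition [FiniteDimensional ℂ V] (hρ : IsRational ρ) :
    ∃ P : (Fin n → ℤ) →₀ Module.End ℂ V, IsWeightDecomposition ρ P := by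
  classical
  set b := Module.finBasis ℂ V
  choose l hl using fun a c => exists_laurent_coeff hρ (b.coord a) (b c)
  let e : Fin (Module.finrank ℂ V) → Fin (Module.finrank ℂ V) → Module.End ℂ V :=
    fun a c => (b.coord c).smulRight (b a)
  let F : (Fin n → ℂˣ) → ((Fin n → ℤ) →₀ Module.End ℂ V) →ₗ[ℂ] Module.End ℂ V := fun z =>
    Finsupp.lsum ℂ fun μ => torusChar μ z • LinearMap.id
  refine ⟨∑ a, ∑ c, (l a c).coeff.mapRange (fun s => s • e a c) (zero_smul _ _), fun z => ?_⟩
  have hF : ∀ Q, (Q.sum fun μ T => torusChar μ z • T) = F z Q := fun Q => rfl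
  rw [hF, map_sum]
  simp only [map_sum]
  have h1 : ∀ a c, F z ((l a c).coeff.mapRange (fun s => s • e a c) (zero_smul _ _)) =
      (b.coord a (ρ (torusElt z) (b c))) • e a c := by
    intro a c
    rw [← hF, Finsupp.sum_mapRange_index (by simp), hl, ev_eq_sum, Finsupp.sum, Finsupp.sum,
      Finset.sum_smul]
    exact Finset.sum_congr rfl fun μ _ => by rw [smul_eq_mul, mul_smul]
  simp only [h1]
  refine b.ext fun d => ?_
  simp only [LinearMap.sum_apply, LinearMap.smul_apply, e, LinearMap.smulRight_apply,
    Module.Basis.coord_apply, Module.Basis.repr_self]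
  conv_lhs => rw [← b.sum_repr (ρ (torusElt z) (b d))]
  refine Finset.sum_congr rfl fun a _ => ?_
  rw [Finset.sum_eq_single d]
  · simp
  · intro c _ hc
    simp [hc]
  · simp

variable (ρ) in
/-- The torus acts on `x` by the character `μ`. -/
def IsWeightVec (μ : Fin n → ℤ) (x : V) : Prop :=
  ∀ z, ρ (torusElt z) x = torusChar μ z • x

variable {P : (Fin n → ℤ) →₀ Module.End ℂ V} {E : Matrix (Fin n) (Fin n) ℂ →ₗ[ℂ] Module.End ℂ V}

theorem IsWeightDecomposition.apply (hP : IsWeightDecomposition ρ P) (z : Fin n → ℂˣ) (x : V) :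
    ρ (torusElt z) x = P.sum fun μ T => torusChar μ z • T x := by
  rw [hP z, Finsupp.sum, LinearMap.sum_apply]
  rfl

/-- Both ways of expanding the torus action on `x` are vector-valued Laurent polynomials, so their
coefficients agree. -/
theorem IsWeightDecomposition.apply_weightVec (hP : IsWeightDecomposition ρ P) {μ : Fin n → ℤ}
    {x : V} (hx : IsWeightVec ρ μ x) (ν : Fin n → ℤ) : P ν x = if μ = ν then x else 0 := by
  have h : P.mapRange (fun T => T x) (by simp) = Finsupp.single μ x := by
    refine finsupp_ext_of_torus fun z => ?_
    rw [Finsupp.sum_mapRange_index (by simp), ← hP.apply, hx, Finsupp.sum_single_index (by simp)]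
  have h1 := DFunLike.congr_fun h ν
  rwa [Finsupp.mapRange_apply, Finsupp.single_apply] at h1

theorem hasDerivAt_torusChar_expTorus (μ : Fin n → ℤ) (i : Fin n) :
    HasDerivAt (fun t => torusChar μ (expTorus i t)) (μ i : ℂ) 0 := by
  simp only [expTorus, torusChar_mulSingle, Units.val_mk0, ← Complex.exp_int_mul]
  have h := ((hasDerivAt_id (0 : ℂ)).const_mul (μ i : ℂ)).cexp
  simpa using h

/-- Differentiate the weight expansion of `ρ(z · exp)` along the `i`-th one-parameter subgroup and
compare coefficients in `z`. -/
theorem IsWeightDecomposition.mul_diag (hP : IsWeightDecomposition ρ P)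
    (hE : IsDifferential ρ E) (μ : Fin n → ℤ) (i : Fin n) :
    P μ * E (Matrix.single i i 1) = (μ i : ℂ) • P μ := by
  refine LinearMap.ext fun x => ?_
  have h : P.mapRange (fun T => T (E (Matrix.single i i 1) x)) (by simp) =
      Finsupp.onFinset P.support (fun μ => (μ i : ℂ) • P μ x) fun μ h => by
        rw [Finsupp.mem_support_iff]; rintro h0; exact h (by simp [h0]) := by
    refine finsupp_ext_of_torus fun z => ?_
    rw [Finsupp.sum_mapRange_index (by simp), ← hP.apply, Finsupp.onFinset_sum _ (by simp)]
    refine eq_of_forall_dual fun f => ?_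
    have h1 := hE (fun t => torusElt (expTorus i t)) _ (by simp only [expTorus_zero, torusElt_one])
      (hasDerivAt_expTorus i) (f ∘ₗ ρ (torusElt z)) x
    have h2 : HasDerivAt (fun t => ∑ ν ∈ P.support,
        torusChar ν z * torusChar ν (expTorus i t) * f (P ν x))
        (∑ ν ∈ P.support, torusChar ν z * (ν i : ℂ) * f (P ν x)) 0 :=
      HasDerivAt.fun_sum fun ν _ =>
        ((hasDerivAt_torusChar_expTorus ν i).const_mul _).mul_const _
    have h3 : (fun t => (f ∘ₗ ρ (torusElt z)) (ρ (torusElt (expTorus i t)) x)) = fun t =>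
        ∑ ν ∈ P.support, torusChar ν z * torusChar ν (expTorus i t) * f (P ν x) := by
      funext t
      rw [LinearMap.comp_apply, ← Module.End.mul_apply, ← map_mul, ← torusElt_mul, hP.apply,
        Finsupp.sum, map_sum]
      exact Finset.sum_congr rfl fun ν _ => by rw [map_smul, map_mul, smul_eq_mul]
    rw [h3] at h1
    have h4 := h1.unique h2
    rw [LinearMap.comp_apply] at h4
    rw [h4, map_sum]
    exact Finset.sum_congr rfl fun ν _ => by
      rw [map_smul, map_smul, smul_eq_mul, smul_eq_mul, mul_assoc]
  have h1 := DFunLike.congr_fun h μ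
  simpa using h1

theorem inv_torusElt (z : Fin n → ℂˣ) : (torusElt z)⁻¹ = torusElt z⁻¹ :=
  inv_eq_of_mul_eq_one_right (by rw [← torusElt_mul, mul_inv_cancel, torusElt_one])

theorem IsDifferential.torus_apply (hE : IsDifferential ρ E) (z : Fin n → ℂˣ) (i j : Fin n)
    (x : V) :
    ρ (torusElt z) (E (Matrix.single i j 1) x) =
      ((z i : ℂ) * (z j : ℂ)⁻¹) • E (Matrix.single i j 1) (ρ (torusElt z) x) := by
  rw [hE.conj, inv_torusElt, coe_torusElt, coe_torusElt]
  have h : Matrix.diagonal (fun i => (z i : ℂ)) * Matrix.single i j (1 : ℂ) *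
      Matrix.diagonal (fun i => ((z⁻¹) i : ℂ)) =
      ((z i : ℂ) * (z j : ℂ)⁻¹) • Matrix.single i j (1 : ℂ) := by
    ext k l
    rw [Matrix.mul_diagonal, Matrix.diagonal_mul, Matrix.smul_apply, Matrix.single_apply]
    split_ifs with h
    · obtain ⟨rfl, rfl⟩ := h
      simp
    · simp
  rw [h, map_smul, LinearMap.smul_apply]

theorem IsWeightVec.root (hE : IsDifferential ρ E) {μ : Fin n → ℤ} {x : V}
    (hx : IsWeightVec ρ μ x) (i j : Fin n) :
    IsWeightVec ρ (μ + Pi.single i 1 - Pi.single j 1) (E (Matrix.single i j 1) x) := by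
  intro z
  rw [hE.torus_apply, hx z, map_smul, smul_smul]
  congr 1
  have h : μ + Pi.single i 1 - Pi.single j 1 = μ + (Pi.single i 1 + Pi.single j (-1)) := by
    rw [Pi.single_neg]; abel
  rw [h, torusChar_add, torusChar_add, torusChar_single, torusChar_single]
  simp [mul_comm]

theorem IsWeightVec.diag (hP : IsWeightDecomposition ρ P) (hE : IsDifferential ρ E)
    {μ : Fin n → ℤ} {x : V} (hx : IsWeightVec ρ μ x) (i : Fin n) :
    E (Matrix.single i i 1) x = (μ i : ℂ) • x := by
  have h1 := hx.root hE i i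
  rw [add_sub_cancel_right] at h1
  have h2 := hP.apply_weightVec h1 μ
  have h3 := hP.apply_weightVec hx μ
  rw [if_pos rfl] at h2 h3
  rw [← h2, ← Module.End.mul_apply, hP.mul_diag hE, LinearMap.smul_apply, h3]

/-! ### Traces -/

/-- The Laurent polynomial `z ↦ tr (ρ(z) M)`. -/
noncomputable def traceLaurent (P : (Fin n → ℤ) →₀ Module.End ℂ V) (M : Module.End ℂ V) :
    Laurent n :=
  AddMonoidAlgebra.ofCoeff (P.mapRange (fun T => LinearMap.trace ℂ V (T * M)) (by simp))

theorem traceLaurent_coeff (M : Module.End ℂ V) (μ : Fin n → ℤ) :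
    (traceLaurent P M).coeff μ = LinearMap.trace ℂ V (P μ * M) := rfl

theorem ev_traceLaurent (hP : IsWeightDecomposition ρ P) (M : Module.End ℂ V)
    (z : Fin n → ℂˣ) :
    ev z (traceLaurent P M) = LinearMap.trace ℂ V (ρ (torusElt z) * M) := by
  rw [ev_eq_sum, traceLaurent, AddMonoidAlgebra.coeff_ofCoeff,
    Finsupp.sum_mapRange_index (by simp), hP z, Finsupp.sum, Finsupp.sum, Finset.sum_mul, map_sum]
  exact Finset.sum_congr rfl fun μ _ => by rw [smul_mul_assoc, map_smul]

theorem traceLaurent_add (M N : Module.End ℂ V) :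
    traceLaurent P (M + N) = traceLaurent P M + traceLaurent P N := by
  ext μ
  simp [traceLaurent_coeff, mul_add]

theorem traceLaurent_smul (c : ℂ) (M : Module.End ℂ V) :
    traceLaurent P (c • M) = c • traceLaurent P M := by
  ext μ
  simp [traceLaurent_coeff]

theorem traceLaurent_sum {ι : Type*} (s : Finset ι) (M : ι → Module.End ℂ V) :
    traceLaurent P (∑ a ∈ s, M a) = ∑ a ∈ s, traceLaurent P (M a) := by
  ext μ
  simp [traceLaurent_coeff, Finset.mul_sum, AddMonoidAlgebra.coeff_sum]

theorem traceLaurent_diag_mul (hP : IsWeightDecomposition ρ P) (hE : IsDifferential ρ E)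
    (i : Fin n) (M : Module.End ℂ V) :
    traceLaurent P (E (Matrix.single i i 1) * M) = eulerD i (traceLaurent P M) := by
  ext μ
  rw [traceLaurent_coeff, eulerD_coeff, traceLaurent_coeff, ← mul_assoc, hP.mul_diag hE,
    smul_mul_assoc, map_smul, smul_eq_mul]

/-- Moving `E_ji` to the left past `ρ(z)` costs the root factor `z_j / z_i`; cyclicity of the trace
then brings it round to the other end. -/
theorem lvar_mul_traceLaurent (hP : IsWeightDecomposition ρ P) (hE : IsDifferential ρ E)
    (i j : Fin n) :
    lvar i * traceLaurent P (E (Matrix.single j i 1) * E (Matrix.single i j 1)) =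
      lvar j * traceLaurent P (E (Matrix.single i j 1) * E (Matrix.single j i 1)) := by
  refine ev_ext fun z => ?_
  rw [map_mul, map_mul, ev_lvar, ev_lvar, ev_traceLaurent hP, ev_traceLaurent hP]
  have h : ρ (torusElt z) * (E (Matrix.single j i 1) * E (Matrix.single i j 1)) =
      ((z j : ℂ) * (z i : ℂ)⁻¹) •
        (E (Matrix.single j i 1) * (ρ (torusElt z) * E (Matrix.single i j 1))) := by
    refine LinearMap.ext fun x => ?_
    simp only [Module.End.mul_apply, LinearMap.smul_apply]
    exact hE.torus_apply z j i _
  rw [h, map_smul, LinearMap.trace_mul_comm, smul_eq_mul, mul_assoc (ρ (torusElt z))]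
  have hz := (z i).ne_zero
  field_simp

theorem IsDifferential.bracket_mul (hE : IsDifferential ρ E) {i j : Fin n} (hij : i ≠ j)
    (A : Matrix (Fin n) (Fin n) ℂ) :
    E (Matrix.single i j 1) * E A = E A * E (Matrix.single i j 1) +
      E (Matrix.single i j 1 * A - A * Matrix.single i j 1) :=
  LinearMap.ext fun x => hE.bracket hij A x

theorem traceLaurent_bracket (hP : IsWeightDecomposition ρ P) (hE : IsDifferential ρ E)
    {i j : Fin n} (hij : i ≠ j) :
    traceLaurent P (E (Matrix.single i j 1) * E (Matrix.single j i 1)) =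
      traceLaurent P (E (Matrix.single j i 1) * E (Matrix.single i j 1)) +
        (eulerD i (traceLaurent P 1) - eulerD j (traceLaurent P 1)) := by
  have h : Matrix.single i j (1 : ℂ) * Matrix.single j i 1 -
      Matrix.single j i 1 * Matrix.single i j 1 =
      Matrix.single i i 1 + (-1 : ℂ) • Matrix.single j j 1 := by
    rw [Matrix.single_mul_single_same, Matrix.single_mul_single_same]
    simp [sub_eq_add_neg]
  rw [hE.bracket_mul hij, h, map_add, map_smul, traceLaurent_add, traceLaurent_add,
    traceLaurent_smul, ← traceLaurent_diag_mul hP hE, ← traceLaurent_diag_mul hP hE, mul_one,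
    mul_one, neg_one_smul, sub_eq_add_neg]

/-- A permutation matrix conjugates one torus element into the other. -/
theorem traceLaurent_symm (hP : IsWeightDecomposition ρ P) (σ : Equiv.Perm (Fin n))
    (z : Fin n → ℂˣ) :
    ev (z ∘ σ) (traceLaurent P 1) = ev z (traceLaurent P 1) := by
  have hdet : (σ.permMatrix ℂ).det ≠ 0 := by
    rw [Matrix.det_permutation]
    exact_mod_cast (Equiv.Perm.sign σ).ne_zero
  set g := Matrix.GeneralLinearGroup.mkOfDetNeZero (σ.permMatrix ℂ) hdet with hg
  have hconj : torusElt (z ∘ σ) = g * torusElt z * g⁻¹ := by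
    rw [eq_mul_inv_iff_mul_eq]
    apply Units.ext
    change Matrix.diagonal _ * σ.permMatrix ℂ = σ.permMatrix ℂ * Matrix.diagonal _
    ext i j
    rw [Matrix.diagonal_mul, Matrix.mul_diagonal]
    by_cases h : σ i = j
    · subst h; simp [mul_comm]
    · simp [Equiv.Perm.permMatrix, PEquiv.toMatrix_apply, h]
  rw [ev_traceLaurent hP, ev_traceLaurent hP, mul_one, mul_one, hconj, map_mul ρ, map_mul ρ,
    LinearMap.trace_mul_comm, ← mul_assoc, ← map_mul ρ, inv_mul_cancel, map_one, one_mul]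

end Weights

/-! ### Invariant subspaces -/

section Stable

variable {n : ℕ} {V : Type*} [AddCommGroup V] [Module ℂ V]
  {ρ : Representation ℂ (Matrix.GeneralLinearGroup (Fin n) ℂ) V}
  {P : (Fin n → ℤ) →₀ Module.End ℂ V} {E : Matrix (Fin n) (Fin n) ℂ →ₗ[ℂ] Module.End ℂ V}

theorem exists_polynomial_elemGL (hρ : IsRational ρ) {i j : Fin n} (hij : i ≠ j)
    (f : Module.Dual ℂ V) (x : V) :
    ∃ q : Polynomial ℂ, ∀ t, f (ρ (elemGL hij t) x) = q.eval t := by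
  obtain ⟨Q, N, hQ⟩ := hρ f x
  refine ⟨MvPolynomial.aeval (fun kl : Fin n × Fin n =>
    Polynomial.C ((1 : Matrix (Fin n) (Fin n) ℂ) kl.1 kl.2) +
      Polynomial.C (Matrix.single i j (1 : ℂ) kl.1 kl.2) * Polynomial.X) Q, fun t => ?_⟩
  have hdet : (elemGL hij t : Matrix (Fin n) (Fin n) ℂ).det = 1 :=
    Matrix.det_transvection_of_ne i j hij t
  rw [hQ, hdet, one_pow, div_one, ← Polynomial.coe_aeval_eq_eval, ← MvPolynomial.coe_aeval_eq_eval]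
  have h := DFunLike.congr_fun (MvPolynomial.comp_aeval (R := ℂ) (fun kl : Fin n × Fin n =>
    Polynomial.C ((1 : Matrix (Fin n) (Fin n) ℂ) kl.1 kl.2) +
      Polynomial.C (Matrix.single i j (1 : ℂ) kl.1 kl.2) * Polynomial.X)
    (Polynomial.aeval (R := ℂ) t)) Q
  refine Eq.trans ?_ h.symm
  refine congrArg (fun s => MvPolynomial.aeval s Q) (funext fun kl => ?_)
  simp only [coe_elemGL, Matrix.add_apply, map_add, map_mul, Polynomial.aeval_C,
    Polynomial.aeval_X, Matrix.single_apply]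
  split_ifs <;> simp

/-- For a functional `f` killing `K`, the polynomials `q_y(t) = f(ρ(1 + t E_ij) y)` satisfy `q_y' =
q_{E_ij y}` and, for `y ∈ K`, `q_y(0) = 0`. Induction on the degree makes them vanish for `y ∈ K`,
so no functional separates `ρ(1 + t E_ij) x` from `K`. -/
theorem stable_elemGL (hρ : IsRational ρ) (hE : IsDifferential ρ E) {K : Submodule ℂ V}
    {i j : Fin n} (hij : i ≠ j) (hK : ∀ x ∈ K, E (Matrix.single i j 1) x ∈ K) (t : ℂ) {x : V}
    (hx : x ∈ K) : ρ (elemGL hij t) x ∈ K := by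
  by_contra hcon
  obtain ⟨f, hf, hfK⟩ := Submodule.exists_dual_map_eq_bot_of_notMem hcon inferInstance
  have hf0 : ∀ y ∈ K, f y = 0 := by
    intro y hy
    have : f y ∈ K.map f := Submodule.mem_map_of_mem hy
    rw [hfK] at this
    exact (Submodule.mem_bot ℂ).mp this
  choose q hq using fun y => exists_polynomial_elemGL hρ hij f y
  have hder : ∀ y, (q y).derivative = q (E (Matrix.single i j 1) y) := by
    intro y
    refine Polynomial.funext fun s => ?_
    have h1 := hE (elemGL hij) _ (elemGL_zero hij) (hasDerivAt_elemGL hij)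
      (f ∘ₗ ρ (elemGL hij s)) y
    have h2 : (fun t => (f ∘ₗ ρ (elemGL hij s)) (ρ (elemGL hij t) y)) =
        fun t => (q y).eval (s + t) := by
      funext t
      rw [← hq, elemGL_add, map_mul]; rfl
    have h3 : HasDerivAt (fun t => (q y).eval (s + t)) ((q y).derivative.eval s) 0 := by
      have h4 := (q y).hasDerivAt s
      have h5 : HasDerivAt (fun t : ℂ => s + t) 1 0 := (hasDerivAt_id (0 : ℂ)).const_add s
      have h6 : HasDerivAt (fun t => (q y).eval t) ((q y).derivative.eval s) (s + 0) := by
        rwa [add_zero]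
      have h7 := h6.comp (0 : ℂ) h5
      rw [mul_one] at h7
      exact h7
    rw [h2] at h1
    rw [h3.unique h1, LinearMap.comp_apply, hq]
  have hzero : ∀ d : ℕ, ∀ y ∈ K, (q y).natDegree ≤ d → q y = 0 := by
    intro d
    induction d with
    | zero =>
      intro y hy hd
      have h1 := Polynomial.eq_C_of_natDegree_le_zero hd
      have h2 := hq y 0
      rw [elemGL_zero, map_one, Module.End.one_apply, hf0 y hy] at h2
      rw [h1, Polynomial.eval_C] at h2
      rw [h1, ← h2, Polynomial.C_0]
    | succ d ih =>
      intro y hy hd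
      have h1 : (q y).derivative = 0 := by
        rw [hder]
        refine ih _ (hK y hy) ?_
        rw [← hder]
        have := Polynomial.natDegree_derivative_le (q y)
        omega
      have h2 : (q y).natDegree = 0 := Polynomial.derivative_eq_zero.mp h1
      have h1 := Polynomial.eq_C_of_natDegree_le_zero h2.le
      have h2 := hq y 0
      rw [elemGL_zero, map_one, Module.End.one_apply, hf0 y hy] at h2
      rw [h1, Polynomial.eval_C] at h2
      rw [h1, ← h2, Polynomial.C_0]
  apply hf
  rw [hq, hzero _ x hx le_rfl, Polynomial.eval_zero]

/-- A subspace stable under the torus and the differential is stable under the group. -/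
theorem stable_of_differential (hρ : IsRational ρ) (hE : IsDifferential ρ E) {K : Submodule ℂ V}
    (hT : ∀ z, ∀ x ∈ K, ρ (torusElt z) x ∈ K)
    (hK : ∀ i j, ∀ x ∈ K, E (Matrix.single i j 1) x ∈ K)
    (g : Matrix.GeneralLinearGroup (Fin n) ℂ) : ∀ x ∈ K, ρ g x ∈ K := by
  have key : ∀ M : Matrix (Fin n) (Fin n) ℂ, M.det ≠ 0 →
      ∀ g : Matrix.GeneralLinearGroup (Fin n) ℂ, g.val = M → ∀ x ∈ K, ρ g x ∈ K := by
    intro M hM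
    -- Gaussian elimination: invertible matrices are products of diagonal matrices and
    -- transvections.
    refine Matrix.diagonal_transvection_induction_of_det_ne_zero (fun M =>
      ∀ g : Matrix.GeneralLinearGroup (Fin n) ℂ, g.val = M → ∀ x ∈ K, ρ g x ∈ K) M hM ?_ ?_ ?_
    · intro D hD g hg x hx
      rw [Matrix.det_diagonal, Finset.prod_ne_zero_iff] at hD
      have : g = torusElt fun i => Units.mk0 (D i) (hD i (Finset.mem_univ i)) :=
        Units.ext (by rw [hg, coe_torusElt]; rfl)
      rw [this]
      exact hT _ x hx
    · intro t g hg x hx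
      have : g = elemGL t.hij t.c := Units.ext hg
      rw [this]
      exact stable_elemGL hρ hE t.hij (hK _ _) _ hx
    · intro A B hA hB hA' hB' g hg x hx
      have : g = Matrix.GeneralLinearGroup.mkOfDetNeZero A hA *
          Matrix.GeneralLinearGroup.mkOfDetNeZero B hB := Units.ext hg
      rw [this, map_mul, Module.End.mul_apply]
      exact hA' _ rfl _ (hB' _ rfl x hx)
  exact key g.val (Matrix.GeneralLinearGroup.det_ne_zero g) g rfl

theorem eq_top_of_stable (hirr : ρ.IsIrreducible) {K : Submodule ℂ V}
    (hK : ∀ g, ∀ x ∈ K, ρ g x ∈ K) {v : V} (hv : v ∈ K) (hv0 : v ≠ 0) : K = ⊤ := by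
  let S : Subrepresentation ρ := ⟨K, fun g x hx => hK g x hx⟩
  rcases IsSimpleOrder.eq_bot_or_eq_top S with h | h
  · exfalso
    have hv' : v ∈ S := hv
    rw [h] at hv'
    exact hv0 hv'
  · exact congrArg Subrepresentation.toSubmodule h

/-! ### The weights of an irreducible representation -/

/-- The vectors obtained from `v`, of weight `w`, by applying strictly lower triangular matrix
units, with their weights. -/
inductive LowerVec (E : Matrix (Fin n) (Fin n) ℂ →ₗ[ℂ] Module.End ℂ V) (w : Fin n → ℤ) (v : V) :
    (Fin n → ℤ) → V → Prop
  | base : LowerVec E w v w v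
  | step {μ : Fin n → ℤ} {x : V} {i j : Fin n} (hji : j < i) : LowerVec E w v μ x →
      LowerVec E w v (μ + Pi.single i 1 - Pi.single j 1) (E (Matrix.single i j 1) x)

/-- Sum of the first `k` coordinates. -/
def partialSum (μ : Fin n → ℤ) (k : ℕ) : ℤ := ∑ i : Fin n, if (i : ℕ) < k then μ i else 0

/-- The dominance order on weights. -/
def Dominated (μ w : Fin n → ℤ) : Prop :=
  (∀ k, partialSum μ k ≤ partialSum w k) ∧ ∑ i, μ i = ∑ i, w i

theorem partialSum_add (μ ν : Fin n → ℤ) (k : ℕ) :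
    partialSum (μ + ν) k = partialSum μ k + partialSum ν k := by
  rw [partialSum, partialSum, partialSum, ← Finset.sum_add_distrib]
  exact Finset.sum_congr rfl fun i _ => by split_ifs <;> simp

theorem partialSum_sub (μ ν : Fin n → ℤ) (k : ℕ) :
    partialSum (μ - ν) k = partialSum μ k - partialSum ν k := by
  rw [eq_sub_iff_add_eq, ← partialSum_add, sub_add_cancel]

theorem partialSum_single (i : Fin n) (k : ℕ) :
    partialSum (Pi.single i 1) k = if (i : ℕ) < k then 1 else 0 := by
  rw [partialSum, Finset.sum_eq_single i]
  · simp
  · intro j _ hj; simp [hj]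
  · simp

theorem partialSum_succ (μ : Fin n → ℤ) (i : Fin n) :
    partialSum μ (i + 1) = partialSum μ i + μ i := by
  have h : ∀ j : Fin n, (if (j : ℕ) < i + 1 then μ j else 0) =
      (if (j : ℕ) < i then μ j else 0) + if j = i then μ j else 0 := by
    intro j
    rcases lt_trichotomy (j : ℕ) i with h | h | h
    · have : j ≠ i := fun e => by subst e; omega
      simp [h, this, Nat.lt_succ_of_lt h]
    · have : j = i := Fin.ext h
      subst this; simp
    · have : j ≠ i := fun e => by subst e; omega
      simp [this, show ¬ (j : ℕ) < i by omega, show ¬ (j : ℕ) < i + 1 by omega]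
  rw [partialSum, partialSum, Finset.sum_congr rfl fun j _ => h j, Finset.sum_add_distrib]
  simp

theorem eq_of_partialSum_eq {μ ν : Fin n → ℤ} (h : ∀ k, partialSum μ k = partialSum ν k) :
    μ = ν := by
  funext i
  have h1 := partialSum_succ μ i
  have h2 := partialSum_succ ν i
  have h3 := h i
  have h4 := h (i + 1)
  omega

theorem Dominated.refl (w : Fin n → ℤ) : Dominated w w := ⟨fun _ => le_rfl, rfl⟩

theorem Dominated.add {μ ν w w' : Fin n → ℤ} (h : Dominated μ w) (h' : Dominated ν w') :
    Dominated (μ + ν) (w + w') := by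
  refine ⟨fun k => ?_, ?_⟩
  · rw [partialSum_add, partialSum_add]
    exact add_le_add (h.1 k) (h'.1 k)
  · simp only [Pi.add_apply, Finset.sum_add_distrib, h.2, h'.2]

theorem Dominated.lower {μ w : Fin n → ℤ} (h : Dominated μ w) {i j : Fin n} (hji : j < i) :
    Dominated (μ + Pi.single i 1 - Pi.single j 1) w := by
  refine ⟨fun k => ?_, ?_⟩
  · rw [partialSum_sub, partialSum_add, partialSum_single, partialSum_single]
    have h1 := h.1 k
    have h2 : (j : ℕ) < i := hji
    split_ifs <;> omega
  · simp [Finset.sum_add_distrib, h.2]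

theorem LowerVec.dominated {w : Fin n → ℤ} {v : V} {μ : Fin n → ℤ} {x : V}
    (h : LowerVec E w v μ x) : Dominated μ w := by
  induction h with
  | base => exact Dominated.refl w
  | step hji _ ih => exact ih.lower hji

/-- Each lowering step strictly increases `∑ i * μ i`, so weight `w` is reached only by the empty
word. This gives multiplicity one. -/
theorem LowerVec.eq_or_height_lt {w : Fin n → ℤ} {v : V} {μ : Fin n → ℤ} {x : V}
    (h : LowerVec E w v μ x) :
    (μ = w ∧ x = v) ∨ ∑ i : Fin n, (i : ℤ) * w i < ∑ i : Fin n, (i : ℤ) * μ i := by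
  induction h with
  | base => exact Or.inl ⟨rfl, rfl⟩
  | @step μ x i j hji h ih =>
    right
    have h1 : ∑ k : Fin n, (k : ℤ) * (μ + Pi.single i 1 - Pi.single j 1 : Fin n → ℤ) k =
        ∑ k : Fin n, (k : ℤ) * μ k + i - j := by
      simp only [Pi.add_apply, Pi.sub_apply, mul_sub, mul_add, Finset.sum_sub_distrib,
        Finset.sum_add_distrib, Pi.single_apply, mul_ite, mul_one, mul_zero, Finset.sum_ite_eq',
        Finset.mem_univ, if_true]
    have h2 : (j : ℕ) < i := hji
    rw [h1]
    rcases ih with ⟨rfl, _⟩ | ih <;> omega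

theorem LowerVec.isWeightVec (hE : IsDifferential ρ E) {w : Fin n → ℤ} {v : V}
    (hv : IsWeightVec ρ w v) {μ : Fin n → ℤ} {x : V} (h : LowerVec E w v μ x) :
    IsWeightVec ρ μ x := by
  induction h with
  | base => exact hv
  | step _ _ ih => exact ih.root hE _ _

/-- The span of the vectors obtained from `v` by lowering operators. -/
def lowerSpan (E : Matrix (Fin n) (Fin n) ℂ →ₗ[ℂ] Module.End ℂ V) (w : Fin n → ℤ) (v : V) :
    Submodule ℂ V := Submodule.span ℂ {x | ∃ μ, LowerVec E w v μ x}

theorem LowerVec.mem {w : Fin n → ℤ} {v : V} {μ : Fin n → ℤ} {x : V} (h : LowerVec E w v μ x) :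
    x ∈ lowerSpan E w v := Submodule.subset_span ⟨μ, h⟩

theorem lowerSpan_lower {w : Fin n → ℤ} {v : V} {i j : Fin n} (hji : j < i) {x : V}
    (hx : x ∈ lowerSpan E w v) : E (Matrix.single i j 1) x ∈ lowerSpan E w v := by
  induction hx using Submodule.span_induction with
  | mem x hx => obtain ⟨μ, hμ⟩ := hx; exact (LowerVec.step hji hμ).mem
  | zero => rw [map_zero]; exact Submodule.zero_mem _
  | add x y _ _ hx hy => rw [map_add]; exact Submodule.add_mem _ hx hy
  | smul c x _ hx => rw [map_smul]; exact Submodule.smul_mem _ c hx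

/-- Commuting `E A` past the last lowering operator produces a bracket, which is again of the form
`E A'`. The claim therefore has to be inductive for all matrices at once. -/
theorem LowerVec.differential_mem (hP : IsWeightDecomposition ρ P) (hE : IsDifferential ρ E)
    {w : Fin n → ℤ} {v : V} (hv : IsWeightVec ρ w v)
    (hup : ∀ i j, i < j → E (Matrix.single i j 1) v = 0) {μ : Fin n → ℤ} {x : V}
    (h : LowerVec E w v μ x) : ∀ A, E A x ∈ lowerSpan E w v := by
  induction h with
  | base =>
    intro A
    rw [Matrix.matrix_eq_sum_single A]
    simp only [map_sum, LinearMap.sum_apply]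
    refine Submodule.sum_mem _ fun i _ => Submodule.sum_mem _ fun j _ => ?_
    have hs : Matrix.single i j (A i j) = A i j • Matrix.single i j (1 : ℂ) := by
      rw [Matrix.smul_single, smul_eq_mul, mul_one]
    rw [hs, map_smul, LinearMap.smul_apply]
    refine Submodule.smul_mem _ _ ?_
    rcases lt_trichotomy i j with hij | hij | hij
    · rw [hup i j hij]; exact Submodule.zero_mem _
    · subst hij
      rw [hv.diag hP hE]
      exact Submodule.smul_mem _ _ LowerVec.base.mem
    · exact (LowerVec.step hij LowerVec.base).mem
  | @step μ x i j hji h ih =>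
    intro A
    have h1 := hE.bracket hji.ne' A x
    rw [eq_comm, ← eq_sub_iff_add_eq] at h1
    rw [h1]
    exact Submodule.sub_mem _ (lowerSpan_lower hji (ih A)) (ih _)

theorem lowerSpan_eq_top (hρ : IsRational ρ) (hirr : ρ.IsIrreducible)
    (hP : IsWeightDecomposition ρ P) (hE : IsDifferential ρ E) {w : Fin n → ℤ} {v : V}
    (hv0 : v ≠ 0) (hv : IsWeightVec ρ w v)
    (hup : ∀ i j, i < j → E (Matrix.single i j 1) v = 0) : lowerSpan E w v = ⊤ := by
  refine eq_top_of_stable hirr (stable_of_differential hρ hE ?_ ?_) LowerVec.base.mem hv0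
  · intro z x hx
    induction hx using Submodule.span_induction with
    | mem x hx =>
      obtain ⟨μ, hμ⟩ := hx
      rw [hμ.isWeightVec hE hv z]
      exact Submodule.smul_mem _ _ hμ.mem
    | zero => rw [map_zero]; exact Submodule.zero_mem _
    | add x y _ _ hx hy => rw [map_add]; exact Submodule.add_mem _ hx hy
    | smul c x _ hx => rw [map_smul]; exact Submodule.smul_mem _ c hx
  · intro i j x hx
    induction hx using Submodule.span_induction with
    | mem x hx => obtain ⟨μ, hμ⟩ := hx; exact hμ.differential_mem hP hE hv hup _
    | zero => rw [map_zero]; exact Submodule.zero_mem _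
    | add x y _ _ hx hy => rw [map_add]; exact Submodule.add_mem _ hx hy
    | smul c x _ hx => rw [map_smul]; exact Submodule.smul_mem _ c hx

theorem weightProj_eq_zero (hP : IsWeightDecomposition ρ P) (hE : IsDifferential ρ E)
    {w : Fin n → ℤ} {v : V} (hv : IsWeightVec ρ w v) (htop : lowerSpan E w v = ⊤)
    {μ : Fin n → ℤ} (hμ : ¬ Dominated μ w) : P μ = 0 := by
  refine LinearMap.ext_on htop ?_
  rintro x ⟨ν, hν⟩
  rw [hP.apply_weightVec (hν.isWeightVec hE hv), if_neg, LinearMap.zero_apply]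
  rintro rfl
  exact hμ hν.dominated

theorem weightProj_isProj (hP : IsWeightDecomposition ρ P) (hE : IsDifferential ρ E)
    {w : Fin n → ℤ} {v : V} (hv : IsWeightVec ρ w v) (htop : lowerSpan E w v = ⊤) :
    LinearMap.IsProj (Submodule.span ℂ {v}) (P w) := by
  refine ⟨fun x => ?_, fun x hx => ?_⟩
  · have hx : x ∈ lowerSpan E w v := htop ▸ Submodule.mem_top
    induction hx using Submodule.span_induction with
    | mem x hx =>
      obtain ⟨ν, hν⟩ := hx
      rw [hP.apply_weightVec (hν.isWeightVec hE hv)]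
      split_ifs with h
      · subst h
        rcases hν.eq_or_height_lt with ⟨_, rfl⟩ | h
        · exact Submodule.mem_span_singleton_self _
        · exact absurd h (lt_irrefl _)
      · exact Submodule.zero_mem _
    | zero => rw [map_zero]; exact Submodule.zero_mem _
    | add x y _ _ hx hy => rw [map_add]; exact Submodule.add_mem _ hx hy
    | smul c x _ hx => rw [map_smul]; exact Submodule.smul_mem _ c hx
  · obtain ⟨c, rfl⟩ := Submodule.mem_span_singleton.mp hx
    rw [map_smul, hP.apply_weightVec hv, if_pos rfl]

theorem traceLaurent_one_coeff_eq_zero (hP : IsWeightDecomposition ρ P)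
    (hE : IsDifferential ρ E) {w : Fin n → ℤ} {v : V} (hv : IsWeightVec ρ w v)
    (htop : lowerSpan E w v = ⊤) {μ : Fin n → ℤ} (hμ : ¬ Dominated μ w) :
    (traceLaurent P 1).coeff μ = 0 := by
  rw [traceLaurent_coeff, weightProj_eq_zero hP hE hv htop hμ, zero_mul, map_zero]

theorem traceLaurent_one_coeff_highest [FiniteDimensional ℂ V] (hP : IsWeightDecomposition ρ P)
    (hE : IsDifferential ρ E) {w : Fin n → ℤ} {v : V} (hv0 : v ≠ 0) (hv : IsWeightVec ρ w v)
    (htop : lowerSpan E w v = ⊤) :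
    (traceLaurent P 1).coeff w = 1 := by
  rw [traceLaurent_coeff, mul_one, (weightProj_isProj hP hE hv htop).trace,
    finrank_span_singleton hv0, Nat.cast_one]

/-! ### The Casimir operator -/

/-- The quadratic Casimir operator. -/
noncomputable def casimir (E : Matrix (Fin n) (Fin n) ℂ →ₗ[ℂ] Module.End ℂ V) :
    Module.End ℂ V :=
  ∑ i, ∑ j, E (Matrix.single i j 1) * E (Matrix.single j i 1)

/-- Expanding the commutator yields four single sums, which cancel in pairs: `s1` against `s4` and
`s2` against `s3`. -/
theorem casimir_comm (hE : IsDifferential ρ E) {k l : Fin n} (hkl : k ≠ l) :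
    E (Matrix.single k l 1) * casimir E = casimir E * E (Matrix.single k l 1) := by
  have hbr : ∀ i j, E (Matrix.single k l 1) * E (Matrix.single i j 1) =
      E (Matrix.single i j 1) * E (Matrix.single k l 1) +
        ((if l = i then E (Matrix.single k j 1) else 0) -
          if j = k then E (Matrix.single i l 1) else 0) := by
    intro i j
    rw [hE.bracket_mul hkl, map_sub]
    congr 2
    · split_ifs with h
      · subst h; rw [Matrix.single_mul_single_same, mul_one]
      · rw [Matrix.single_mul_single_of_ne _ _ _ _ h, map_zero]
    · split_ifs with h
      · subst h; rw [Matrix.single_mul_single_same, mul_one]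
      · rw [Matrix.single_mul_single_of_ne _ _ _ _ h, map_zero]
  have hterm : ∀ i j, E (Matrix.single k l 1) * (E (Matrix.single i j 1) * E (Matrix.single j i 1)) =
      E (Matrix.single i j 1) * E (Matrix.single j i 1) * E (Matrix.single k l 1) +
      (((if l = i then E (Matrix.single k j 1) * E (Matrix.single j i 1) else 0) -
          if j = k then E (Matrix.single i l 1) * E (Matrix.single j i 1) else 0) +
        ((if l = j then E (Matrix.single i j 1) * E (Matrix.single k i 1) else 0) -
          if i = k then E (Matrix.single i j 1) * E (Matrix.single j l 1) else 0)) := by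
    intro i j
    rw [← mul_assoc, hbr i j, add_mul, mul_assoc, hbr j i, mul_add, sub_mul, mul_sub, ite_mul,
      ite_mul, mul_ite, mul_ite, zero_mul, mul_zero, mul_assoc]
    abel
  rw [casimir, Finset.mul_sum, Finset.sum_mul]
  simp only [Finset.mul_sum, Finset.sum_mul, hterm, Finset.sum_add_distrib, Finset.sum_sub_distrib]
  have s1 : ∑ i, ∑ j, (if l = i then E (Matrix.single k j 1) * E (Matrix.single j i 1) else 0) =
      ∑ j, E (Matrix.single k j 1) * E (Matrix.single j l 1) := by
    rw [Finset.sum_comm]; simp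
  have s2 : ∑ i, ∑ j, (if j = k then E (Matrix.single i l 1) * E (Matrix.single j i 1) else 0) =
      ∑ i, E (Matrix.single i l 1) * E (Matrix.single k i 1) := by simp
  have s3 : ∑ i, ∑ j, (if l = j then E (Matrix.single i j 1) * E (Matrix.single k i 1) else 0) =
      ∑ i, E (Matrix.single i l 1) * E (Matrix.single k i 1) := by simp
  have s4 : ∑ i, ∑ j, (if i = k then E (Matrix.single i j 1) * E (Matrix.single j l 1) else 0) =
      ∑ j, E (Matrix.single k j 1) * E (Matrix.single j l 1) := by
    rw [Finset.sum_comm]; simp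
  rw [s1, s2, s3, s4]
  abel

/-- The operator preserves weight `w`, whose weight space is the line of `v`, so it acts on `v` by a
scalar. Commuting with the lowering operators, it acts by that scalar everywhere. -/
theorem casimir_eq_smul (hP : IsWeightDecomposition ρ P) (hE : IsDifferential ρ E)
    {w : Fin n → ℤ} {v : V} (hv : IsWeightVec ρ w v) (htop : lowerSpan E w v = ⊤) :
    ∃ c : ℂ, casimir E = c • 1 := by
  have hw : P w (casimir E v) = casimir E v := by
    simp only [casimir, LinearMap.sum_apply, map_sum, Module.End.mul_apply]
    refine Finset.sum_congr rfl fun i _ => Finset.sum_congr rfl fun j _ => ?_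
    have h := (hv.root hE j i).root hE i j
    have e : w + Pi.single j 1 - Pi.single i 1 + Pi.single i 1 - Pi.single j 1 = w := by abel
    rw [e] at h
    rw [hP.apply_weightVec h, if_pos rfl]
  obtain ⟨c, hc⟩ := Submodule.mem_span_singleton.mp
    (hw ▸ (weightProj_isProj hP hE hv htop).map_mem (casimir E v))
  refine ⟨c, LinearMap.ext_on htop ?_⟩
  rintro x ⟨ν, hν⟩
  induction hν with
  | base => exact hc.symm
  | @step μ x i j hji h ih =>
    have h1 := LinearMap.congr_fun (casimir_comm hE hji.ne') x
    rw [Module.End.mul_apply, Module.End.mul_apply] at h1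
    rw [← h1, ih]
    simp

end Stable

/-! ### The Laplace operator -/

/-- The Laplace operator on Laurent polynomials. -/
noncomputable def laplace {n : ℕ} (f : Laurent n) : Laurent n := ∑ i, eulerD i (eulerD i f)

theorem laplace_coeff {n : ℕ} (f : Laurent n) (μ : Fin n → ℤ) :
    (laplace f).coeff μ = ((∑ i, μ i ^ 2 : ℤ) : ℂ) * f.coeff μ := by
  rw [laplace, AddMonoidAlgebra.coeff_sum, Finset.sum_apply', Int.cast_sum, Finset.sum_mul]
  refine Finset.sum_congr rfl fun i _ => ?_
  rw [eulerD_coeff, eulerD_coeff]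
  push_cast
  ring

theorem laplace_mul {n : ℕ} (f g : Laurent n) :
    laplace (f * g) = laplace f * g + 2 * ∑ i, eulerD i f * eulerD i g + f * laplace g := by
  simp only [laplace, eulerD_mul, map_add, Finset.sum_mul, Finset.mul_sum,
    ← Finset.sum_add_distrib]
  exact Finset.sum_congr rfl fun i _ => by ring

theorem alternant_coeff_ne_zero {n : ℕ} {ν μ : Fin n → ℤ} (h : (alternant ν).coeff μ ≠ 0) :
    ∃ σ : Equiv.Perm (Fin n), μ = ν ∘ σ := by
  by_contra hcon
  push Not at hcon
  apply h
  rw [alternant_eq_sum, AddMonoidAlgebra.coeff_sum, Finset.sum_apply']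
  refine Finset.sum_eq_zero fun σ _ => ?_
  simp [(hcon σ).symm]

theorem alternant_coeff_comp {n : ℕ} {ν : Fin n → ℤ} (hν : Function.Injective ν)
    (τ : Equiv.Perm (Fin n)) :
    (alternant ν).coeff (ν ∘ τ) = ((Equiv.Perm.sign τ : ℤ) : ℂ) := by
  rw [alternant_eq_sum, AddMonoidAlgebra.coeff_sum, Finset.sum_apply', Finset.sum_eq_single τ]
  · simp
  · intro σ _ hσ
    have : ν ∘ σ ≠ ν ∘ τ := fun h => hσ (Equiv.ext fun i => hν (congrFun h i))
    simp [this]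
  · simp

/-- All exponents occurring are rearrangements of `ν`, hence have the same squared norm. -/
theorem laplace_alternant {n : ℕ} (ν : Fin n → ℤ) :
    laplace (alternant ν) = ((∑ i, ν i ^ 2 : ℤ) : ℂ) • alternant ν := by
  ext μ
  rw [laplace_coeff, AddMonoidAlgebra.coeff_smul_apply, smul_eq_mul]
  by_cases h : (alternant ν).coeff μ = 0
  · rw [h, mul_zero, mul_zero]
  · obtain ⟨σ, rfl⟩ := alternant_coeff_ne_zero h
    congr 2
    exact Equiv.sum_comp σ fun i => ν i ^ 2

theorem eulerD_lvar {n : ℕ} (i k : Fin n) :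
    eulerD i (lvar k) = if k = i then lvar k else 0 := by
  rw [lvar, eulerD_single]
  split_ifs with h
  · subst h; simp
  · simp [Ne.symm h]

/-- The cross term in the Laplace operator applied to a multiple of the Vandermonde determinant. -/
theorem sum_eulerD_alternant {n : ℕ} (X : Laurent n) (T : Fin n → Fin n → Laurent n)
    (hT : ∀ i j, i < j → (lvar j - lvar i) * T i j =
      (lvar i + lvar j) * (eulerD j X - eulerD i X)) :
    2 * ∑ i, eulerD i (alternant (delta n)) * eulerD i X =
      alternant (delta n) * ∑ i, ∑ j ∈ Finset.Ioi i, (T i j + (eulerD i X + eulerD j X)) := by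
  classical
  rw [alternant_delta_eq_prod, Finset.prod_sigma', Finset.sum_sigma']
  set s := (Finset.univ : Finset (Fin n)).sigma fun i => Finset.Ioi i with hs
  simp only [eulerD_prod]
  simp only [Finset.sum_mul]
  rw [Finset.sum_comm, Finset.mul_sum, Finset.mul_sum]
  refine Finset.sum_congr rfl fun a ha => ?_
  have hlt : a.1 < a.2 := by
    rw [hs, Finset.mem_sigma] at ha
    exact Finset.mem_Ioi.mp ha.2
  rw [← Finset.mul_prod_erase s _ ha]
  have h1 : ∑ i, eulerD i (lvar a.2 - lvar a.1) * eulerD i X =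
      lvar a.2 * eulerD a.2 X - lvar a.1 * eulerD a.1 X := by
    simp only [map_sub, eulerD_lvar, sub_mul, Finset.sum_sub_distrib, ite_mul, zero_mul,
      Finset.sum_ite_eq, Finset.mem_univ, if_true]
  have h2 : ∑ i, (eulerD i (lvar a.2 - lvar a.1) *
      ∏ b ∈ s.erase a, (lvar b.2 - lvar b.1)) * eulerD i X =
      (∏ b ∈ s.erase a, (lvar b.2 - lvar b.1)) *
        (lvar a.2 * eulerD a.2 X - lvar a.1 * eulerD a.1 X) := by
    rw [← h1, Finset.mul_sum]
    exact Finset.sum_congr rfl fun i _ => by ring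
  rw [h2]
  -- With `D_i = eulerD i`, `hT` amounts to `2 (z_j D_j X - z_i D_i X) = (z_j - z_i) (T i j + D_i X
  -- + D_j X)` for each Vandermonde factor.
  linear_combination (-(∏ b ∈ s.erase a, (lvar b.2 - lvar b.1))) * hT a.1 a.2 hlt

theorem sum_sum_Ioi_add {n : ℕ} {M : Type*} [AddCommMonoid M] (f : Fin n → M) :
    ∑ i, ∑ j ∈ Finset.Ioi i, (f i + f j) = (n - 1) • ∑ i, f i := by
  simp only [Finset.sum_add_distrib]
  have h : ∑ i : Fin n, ∑ j ∈ Finset.Ioi i, f j = ∑ j : Fin n, ∑ _i ∈ Finset.Iio j, f j := by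
    refine Finset.sum_comm' fun i j => ?_
    simp
  rw [h, ← Finset.sum_add_distrib, Finset.smul_sum]
  refine Finset.sum_congr rfl fun i _ => ?_
  rw [Finset.sum_const, Finset.sum_const, Fin.card_Ioi, Fin.card_Iio, ← add_smul]
  congr 1
  omega

theorem sum_split_Ioi {n : ℕ} {M : Type*} [AddCommMonoid M] (f : Fin n → Fin n → M) :
    ∑ i, ∑ j, f i j = ∑ i, f i i + ∑ i, ∑ j ∈ Finset.Ioi i, (f i j + f j i) := by
  simp only [Finset.sum_add_distrib]
  have h : ∑ i : Fin n, ∑ j ∈ Finset.Ioi i, f j i = ∑ j : Fin n, ∑ i ∈ Finset.Iio j, f j i := by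
    refine Finset.sum_comm' fun i j => ?_
    simp
  rw [h, ← Finset.sum_add_distrib, ← Finset.sum_add_distrib]
  refine Finset.sum_congr rfl fun i _ => ?_
  have hu : (Finset.univ : Finset (Fin n)) = {i} ∪ (Finset.Ioi i ∪ Finset.Iio i) := by
    ext j
    simp only [Finset.mem_univ, Finset.mem_union, Finset.mem_singleton, Finset.mem_Ioi,
      Finset.mem_Iio, true_iff]
    rcases lt_trichotomy i j with h | h | h
    · exact Or.inr (Or.inl h)
    · exact Or.inl h.symm
    · exact Or.inr (Or.inr h)
  rw [hu, Finset.sum_union, Finset.sum_union, Finset.sum_singleton]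
  · rw [Finset.disjoint_left]
    intro j hj hj'
    exact lt_asymm (Finset.mem_Ioi.mp hj) (Finset.mem_Iio.mp hj')
  · rw [Finset.disjoint_left]
    intro j hj hj'
    rw [Finset.mem_singleton] at hj
    subst hj
    simp at hj'

/-! ### The character as a Laplace eigenfunction, and comparison of exponents -/

section Character

variable {n : ℕ} {V : Type*} [AddCommGroup V] [Module ℂ V]
  {ρ : Representation ℂ (Matrix.GeneralLinearGroup (Fin n) ℂ) V}
  {P : (Fin n → ℤ) →₀ Module.End ℂ V} {E : Matrix (Fin n) (Fin n) ℂ →ₗ[ℂ] Module.End ℂ V}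

/-- The Vandermonde multiple of the character is an eigenfunction of the Laplace operator. -/
theorem laplace_alternant_mul_trace (hP : IsWeightDecomposition ρ P) (hE : IsDifferential ρ E)
    {w : Fin n → ℤ} {v : V} (hv : IsWeightVec ρ w v) (htop : lowerSpan E w v = ⊤) :
    ∃ κ : ℂ, laplace (alternant (delta n) * traceLaurent P 1) =
      κ • (alternant (delta n) * traceLaurent P 1) := by
  set X := traceLaurent P 1 with hX
  obtain ⟨c, hc⟩ := casimir_eq_smul hP hE hv htop
  set Z : Fin n → Fin n → Laurent n := fun i j =>
    traceLaurent P (E (Matrix.single i j 1) * E (Matrix.single j i 1)) with hZ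
  -- The trace of the Casimir operator against the torus: diagonal terms give the Laplace operator,
  -- off-diagonal ones pair up.
  have hcas : laplace X + ∑ i, ∑ j ∈ Finset.Ioi i, (Z i j + Z j i) = c • X := by
    rw [hX, ← traceLaurent_smul, ← hc, casimir]
    simp only [traceLaurent_sum]
    rw [sum_split_Ioi, laplace]
    congr 1
    refine Finset.sum_congr rfl fun i _ => ?_
    rw [traceLaurent_diag_mul hP hE, ← traceLaurent_diag_mul hP hE, mul_one]
  have hT : ∀ i j, i < j → (lvar j - lvar i) * (Z i j + Z j i) =
      (lvar i + lvar j) * (eulerD j X - eulerD i X) := by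
    intro i j hij
    have h1 : lvar i * Z j i = lvar j * Z i j := lvar_mul_traceLaurent hP hE i j
    have h2 : Z i j = Z j i + (eulerD i X - eulerD j X) := traceLaurent_bracket hP hE hij.ne
    linear_combination (-2) * h1 - (lvar i + lvar j) * h2
  -- All weights have the total degree of `w`, so the first-order part remaining in the cross term
  -- is a scalar too.
  have hdeg : ∑ i, eulerD i X = ((∑ i, w i : ℤ) : ℂ) • X := by
    ext μ
    rw [AddMonoidAlgebra.coeff_sum, Finset.sum_apply', AddMonoidAlgebra.coeff_smul_apply,
      smul_eq_mul]
    simp only [eulerD_coeff]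
    rw [← Finset.sum_mul, ← Int.cast_sum]
    by_cases hμ : Dominated μ w
    · rw [hμ.2]
    · rw [hX, traceLaurent_one_coeff_eq_zero hP hE hv htop hμ, mul_zero, mul_zero]
  have hcross := sum_eulerD_alternant X (fun i j => Z i j + Z j i) hT
  have hsum : ∑ i, ∑ j ∈ Finset.Ioi i, (Z i j + Z j i + (eulerD i X + eulerD j X)) =
      c • X - laplace X + (n - 1) • ((∑ i, w i : ℤ) : ℂ) • X := by
    rw [← hdeg, ← sum_sum_Ioi_add, ← hcas]
    simp only [Finset.sum_add_distrib]
    abel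
  refine ⟨((∑ i, delta n i ^ 2 : ℤ) : ℂ) + c + ((n - 1 : ℕ) : ℂ) * ((∑ i, w i : ℤ) : ℂ), ?_⟩
  rw [laplace_mul, hcross, hsum, laplace_alternant, ← Nat.cast_smul_eq_nsmul ℂ, smul_smul,
    add_smul, add_smul, smul_mul_assoc, mul_add, mul_sub, mul_smul_comm, mul_smul_comm]
  abel

theorem coeff_mul_ne_zero {f g : Laurent n} {μ : Fin n → ℤ} (h : (f * g).coeff μ ≠ 0) :
    ∃ α β, f.coeff α ≠ 0 ∧ g.coeff β ≠ 0 ∧ α + β = μ := by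
  classical
  by_contra hcon
  push Not at hcon
  apply h
  rw [AddMonoidAlgebra.coeff_mul]
  refine Finset.sum_eq_zero fun α hα => Finset.sum_eq_zero fun β hβ => ?_
  exact if_neg (hcon α β (Finsupp.mem_support_iff.mp hα) (Finsupp.mem_support_iff.mp hβ))

/-- Leading coefficients multiply: if `α + β = μ + ν`, the two families of partial sum inequalities
add up to equalities, so each is an equality. -/
theorem coeff_mul_of_dominated {f g : Laurent n} {μ ν : Fin n → ℤ}
    (hf : ∀ α, f.coeff α ≠ 0 → Dominated α μ) (hg : ∀ β, g.coeff β ≠ 0 → Dominated β ν) :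
    (f * g).coeff (μ + ν) = f.coeff μ * g.coeff ν := by
  classical
  have key : ∀ α β, f.coeff α ≠ 0 → g.coeff β ≠ 0 → α + β = μ + ν → α = μ ∧ β = ν := by
    intro α β hα hβ h
    have h1 := (hf α hα).1
    have h2 := (hg β hβ).1
    have h3 : ∀ k, partialSum α k + partialSum β k = partialSum μ k + partialSum ν k := by
      intro k; rw [← partialSum_add, ← partialSum_add, h]
    exact ⟨eq_of_partialSum_eq fun k => by have := h1 k; have := h2 k; have := h3 k; omega,
      eq_of_partialSum_eq fun k => by have := h1 k; have := h2 k; have := h3 k; omega⟩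
  rw [AddMonoidAlgebra.coeff_mul, Finsupp.sum, Finset.sum_eq_single μ]
  · rw [Finsupp.sum, Finset.sum_eq_single ν]
    · rw [if_pos rfl]
    · intro β hβ hne
      exact if_neg fun h => hne (add_left_cancel h)
    · intro hν
      rw [Finsupp.notMem_support_iff.mp hν, mul_zero, ite_self]
  · intro α hα hne
    refine Finset.sum_eq_zero fun β hβ => if_neg fun h => hne ?_
    exact (key α β (Finsupp.mem_support_iff.mp hα) (Finsupp.mem_support_iff.mp hβ) h).1
  · intro hμ
    rw [Finsupp.notMem_support_iff.mp hμ]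
    simp

/-- Rearrangements of an increasing sequence are dominated by the decreasing one. -/
theorem dominated_comp_perm {ν : Fin n → ℤ} (hν : Monotone ν) (σ : Equiv.Perm (Fin n)) :
    Dominated (ν ∘ σ) (ν ∘ Fin.rev) := by
  refine ⟨fun k => ?_, ?_⟩
  -- The rearrangement inequality against the indicator of the first `k` positions.
  · have hmv : Monovary (fun i : Fin n => if (i : ℕ) < k then (1 : ℤ) else 0) (ν ∘ Fin.rev) := by
      refine Antitone.monovary (fun i j hij => ?_) fun i j hij => hν (Fin.rev_le_rev.mpr hij)
      have : (i : ℕ) ≤ j := hij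
      change (if (j : ℕ) < k then (1 : ℤ) else 0) ≤ if (i : ℕ) < k then 1 else 0
      split_ifs <;> omega
    have h := hmv.sum_mul_comp_perm_le_sum_mul (σ := σ.trans Fin.revPerm)
    simpa [partialSum] using h
  · exact (Equiv.sum_comp σ ν).trans (Equiv.sum_comp Fin.revPerm ν).symm

/-- Abel summation: the difference of the two sides is a sum of terms `(lam_k - lam_{k+1})` times a
partial sum of `d`, all nonnegative. -/
theorem mul_partialSum_le_sum {m : ℕ} {lam d : Fin (m + 1) → ℤ} (hlam : Antitone lam)
    (hd : ∀ k, 0 ≤ partialSum d k) :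
    lam (Fin.last m) * ∑ i, d i ≤ ∑ i, lam i * d i := by
  induction m with
  | zero => simp
  | succ m ih =>
    have hpart : ∀ k, k ≤ m + 1 → partialSum (fun i : Fin (m + 1) => d i.castSucc) k =
        partialSum d k := by
      intro k hk
      rw [partialSum, partialSum, Fin.sum_univ_castSucc (n := m + 1)]
      simp [show ¬ m + 1 < k by omega]
    have hsum : ∑ i : Fin (m + 1), d i.castSucc = partialSum d (m + 1) := by
      rw [← hpart _ le_rfl, partialSum]
      exact Finset.sum_congr rfl fun i _ => by rw [if_pos i.2]
    have h0 : ∀ k, 0 ≤ partialSum (fun i : Fin (m + 1) => d i.castSucc) k := by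
      intro k
      rcases le_or_gt k (m + 1) with hk | hk
      · rw [hpart k hk]; exact hd k
      · have : partialSum (fun i : Fin (m + 1) => d i.castSucc) k = partialSum d (m + 1) := by
          rw [← hsum, partialSum]
          exact Finset.sum_congr rfl fun i _ => by rw [if_pos (by omega)]
        rw [this]; exact hd _
    have h1 := ih (lam := fun i => lam i.castSucc) (d := fun i => d i.castSucc)
      (fun i j hij => hlam (Fin.castSucc_le_castSucc_iff.mpr hij)) h0
    rw [Fin.sum_univ_castSucc, Fin.sum_univ_castSucc (f := fun i => lam i * d i)]
    have h2 : lam (Fin.last (m + 1)) ≤ lam (Fin.last m).castSucc := hlam (Fin.le_last _)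
    have h3 : 0 ≤ ∑ i : Fin (m + 1), d i.castSucc := by rw [hsum]; exact hd _
    have h4 := mul_le_mul_of_nonneg_right h2 h3
    linarith

/-- A decreasing weight dominated by another one of the same length is equal to it. -/
theorem eq_of_dominated_of_sq_eq {lam ν : Fin n → ℤ} (hlam : Antitone lam)
    (hdom : Dominated lam ν) (hsq : ∑ i, lam i ^ 2 = ∑ i, ν i ^ 2) : lam = ν := by
  cases n with
  | zero => exact Subsingleton.elim _ _
  | succ m =>
    have h1 := mul_partialSum_le_sum (d := ν - lam) hlam fun k => by
      rw [partialSum_sub]; exact sub_nonneg.mpr (hdom.1 k)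
    have h2 : ∑ i, (ν - lam) i = 0 := by
      simp only [Pi.sub_apply, Finset.sum_sub_distrib, hdom.2, sub_self]
    rw [h2, mul_zero] at h1
    -- In `|ν|² = |λ|² + 2⟨λ, ν - λ⟩ + |ν - λ|²` the middle term is nonnegative, so equal norms
    -- force `ν = λ`.
    have h3 : ∑ i, ν i ^ 2 = ∑ i, lam i ^ 2 + 2 * ∑ i, lam i * (ν - lam) i +
        ∑ i, (ν - lam) i ^ 2 := by
      rw [Finset.mul_sum, ← Finset.sum_add_distrib, ← Finset.sum_add_distrib]
      exact Finset.sum_congr rfl fun i _ => by simp only [Pi.sub_apply]; ring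
    have h4 : ∑ i, (ν - lam) i ^ 2 = 0 :=
      le_antisymm (by linarith) (Finset.sum_nonneg fun i _ => sq_nonneg _)
    rw [Finset.sum_eq_zero_iff_of_nonneg fun i _ => sq_nonneg _] at h4
    funext i
    have h5 := h4 i (Finset.mem_univ i)
    have h6 := pow_eq_zero_iff (two_ne_zero) |>.mp h5
    simp only [Pi.sub_apply] at h6
    omega

/-- An antisymmetric Laurent polynomial vanishes if its coefficients at decreasing weights do. -/
theorem eq_zero_of_antisymmetric {H : Laurent n}
    (hanti : ∀ (σ : Equiv.Perm (Fin n)) μ,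
      H.coeff (μ ∘ σ) = ((Equiv.Perm.sign σ : ℤ) : ℂ) * H.coeff μ)
    (h0 : ∀ μ, Antitone μ → H.coeff μ = 0) : H = 0 := by
  ext μ
  have hs : Antitone (μ ∘ (Tuple.sort μ * Fin.revPerm : Equiv.Perm (Fin n))) := by
    intro i j hij
    exact Tuple.monotone_sort μ (Fin.rev_le_rev.mpr hij)
  have h1 := h0 _ hs
  rw [hanti] at h1
  have h2 : ((Equiv.Perm.sign (Tuple.sort μ * Fin.revPerm) : ℤ) : ℂ) ≠ 0 := by
    exact_mod_cast (Equiv.Perm.sign _).ne_zero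
  rw [(mul_eq_zero.mp h1).resolve_left h2]
  simp

end Character

theorem strictMono_add_delta {n : ℕ} {p : Fin n → ℤ} (hp : Monotone p) :
    StrictMono (p + delta n) := fun i j hij => by
  have h1 := hp hij.le
  have h2 : (i : ℕ) < j := hij
  simp only [Pi.add_apply, delta]
  omega

/-- The Weyl character formula, in the form of Gelfand and Zetlin. -/
theorem character_eq_gzChar {ℓ : ℕ} {p : Fin (ℓ + 1) → ℤ} (hp : Monotone p) {V : Type*}
    [AddCommGroup V] [Module ℂ V]
    (ρ : Representation ℂ (Matrix.GeneralLinearGroup (Fin (ℓ + 1)) ℂ) V)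
    (h : IsIrrepOfHighestWeight ρ fun i => p i.rev) (z : Fin (ℓ + 1) → ℂˣ) :
    ρ.character (torusElt z) = gzChar ℓ p z := by
  obtain ⟨hfin, hrat, hirr, v, hv0, hvb⟩ := h
  obtain ⟨E, hE⟩ := exists_isDifferential hrat
  obtain ⟨P, hP⟩ := exists_isWeightDecomposition hrat
  set w : Fin (ℓ + 1) → ℤ := fun i => p i.rev with hw
  have hv : IsWeightVec ρ w v := by
    intro y
    rw [hvb (torusElt y)]
    · simp [coe_torusElt, torusChar_apply]
    · intro i j hij
      rw [coe_torusElt, Matrix.diagonal_apply_ne _ hij.ne']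
  -- Upper transvections have unit diagonal and so fix `v`; differentiate.
  have hup : ∀ i j, i < j → E (Matrix.single i j 1) v = 0 := by
    intro i j hij
    refine eq_of_forall_dual fun f => ?_
    have h1 := hE (elemGL hij.ne) _ (elemGL_zero hij.ne) (hasDerivAt_elemGL hij.ne) f v
    have h2 : (fun t => f (ρ (elemGL hij.ne t) v)) = fun _ => f v := by
      funext t
      rw [hvb]
      · have : ∀ k, (elemGL hij.ne t : Matrix (Fin (ℓ + 1)) (Fin (ℓ + 1)) ℂ) k k = 1 := by
          intro k
          rw [coe_elemGL, Matrix.add_apply, Matrix.one_apply_eq, Matrix.single_apply_of_ne, add_zero]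
          rintro ⟨rfl, rfl⟩
          exact hij.ne rfl
        simp [this]
      · intro k l hkl
        rw [coe_elemGL, Matrix.add_apply, Matrix.one_apply_ne hkl.ne', Matrix.single_apply_of_ne,
          add_zero]
        rintro ⟨rfl, rfl⟩
        exact lt_asymm hij hkl
    rw [h2] at h1
    rw [h1.unique (hasDerivAt_const _ _), map_zero]
  have htop := lowerSpan_eq_top hrat hirr hP hE hv0 hv hup
  set X := traceLaurent P 1 with hX
  set a := alternant (delta (ℓ + 1)) with ha
  set ν := p + delta (ℓ + 1) with hν
  have hνs : StrictMono ν := strictMono_add_delta hp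
  have hδs : StrictMono (delta (ℓ + 1)) := by
    simpa using strictMono_add_delta (p := (0 : Fin (ℓ + 1) → ℤ)) monotone_const
  have hνw : ν ∘ Fin.rev = delta (ℓ + 1) ∘ Fin.rev + w := by
    funext i
    simp [hν, hw, add_comm]
  have hXdom : ∀ μ, X.coeff μ ≠ 0 → Dominated μ w := by
    intro μ h
    by_contra hcon
    exact h (traceLaurent_one_coeff_eq_zero hP hE hv htop hcon)
  have hadom : ∀ μ, a.coeff μ ≠ 0 → Dominated μ (delta (ℓ + 1) ∘ Fin.rev) := by
    intro μ h
    obtain ⟨σ, rfl⟩ := alternant_coeff_ne_zero h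
    exact dominated_comp_perm hδs.monotone σ
  -- Both coefficients are the sign of the reversal. Being nonzero, the coefficient also identifies
  -- the Laplace eigenvalue as the squared norm of `ν`.
  have hlead : (a * X).coeff (ν ∘ Fin.rev) = (alternant ν).coeff (ν ∘ Fin.rev) := by
    rw [hνw, coeff_mul_of_dominated hadom hXdom, ← hνw,
      traceLaurent_one_coeff_highest hP hE hv0 hv htop, mul_one]
    exact (alternant_coeff_comp hδs.injective Fin.revPerm).trans
      (alternant_coeff_comp hνs.injective Fin.revPerm).symm
  have hlead0 : (a * X).coeff (ν ∘ Fin.rev) ≠ 0 := by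
    rw [hlead]
    refine (alternant_coeff_comp hνs.injective Fin.revPerm).trans_ne ?_
    exact_mod_cast (Equiv.Perm.sign _).ne_zero
  obtain ⟨κ, hκ⟩ := laplace_alternant_mul_trace hP hE hv htop
  have hκ' : ∀ μ, (a * X).coeff μ ≠ 0 → ((∑ i, μ i ^ 2 : ℤ) : ℂ) = κ := by
    intro μ hμ
    have h1 := congrArg (fun f : Laurent (ℓ + 1) => f.coeff μ) hκ
    simp only [laplace_coeff, AddMonoidAlgebra.coeff_smul_apply, smul_eq_mul] at h1
    exact mul_right_cancel₀ hμ h1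
  have hfin : a * X - alternant ν = 0 := by
    refine eq_zero_of_antisymmetric (fun σ μ => coeff_comp_of_ev_comp (fun y => ?_) μ) ?_
    · rw [map_sub, map_sub, map_mul, map_mul, ev_alternant_comp, ev_alternant_comp,
        traceLaurent_symm hP]
      ring
    · intro μ hμ
      by_contra hne
      have heq : μ = ν ∘ Fin.rev := by
        by_cases h1 : (a * X).coeff μ = 0
        · have h2 : (alternant ν).coeff μ ≠ 0 := by
            intro h2
            apply hne
            rw [AddMonoidAlgebra.coeff_sub, Finsupp.sub_apply, h1, h2, sub_zero]
          obtain ⟨σ, rfl⟩ := alternant_coeff_ne_zero h2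
          refine eq_of_dominated_of_sq_eq hμ (dominated_comp_perm hνs.monotone σ) ?_
          exact (Equiv.sum_comp σ fun i => ν i ^ 2).trans
            (Equiv.sum_comp Fin.revPerm fun i => ν i ^ 2).symm
        · refine eq_of_dominated_of_sq_eq hμ ?_ ?_
          · obtain ⟨α, β, hα, hβ, rfl⟩ := coeff_mul_ne_zero h1
            rw [hνw]
            exact (hadom α hα).add (hXdom β hβ)
          · exact_mod_cast (hκ' μ h1).trans (hκ' _ hlead0).symm
      apply hne
      rw [heq, AddMonoidAlgebra.coeff_sub, Finsupp.sub_apply, hlead, sub_self]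
  have hXgz : X = gzLaurent ℓ p := by
    refine mul_left_cancel₀ (alternant_delta_ne_zero (ℓ + 1)) ?_
    rw [alternant_mul_gzLaurent ℓ p hp]
    exact sub_eq_zero.mp hfin
  rw [gzChar_eq_ev hp, ← hXgz, hX, ev_traceLaurent hP, mul_one]
  rfl

/-! ### Existence of irreducible representations -/

section Rational

variable {n : ℕ}

/-- Rational functions on `GL_n` with powers of the determinant as denominators. -/
def IsRatFun (b : Matrix.GeneralLinearGroup (Fin n) ℂ → ℂ) : Prop :=
  ∃ (Q : MvPolynomial (Fin n × Fin n) ℂ) (N : ℕ), ∀ g : Matrix.GeneralLinearGroup (Fin n) ℂ,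
    b g = MvPolynomial.eval (fun ij => (g : Matrix (Fin n) (Fin n) ℂ) ij.1 ij.2) Q /
      (g : Matrix (Fin n) (Fin n) ℂ).det ^ N

theorem det_coe_ne_zero (g : Matrix.GeneralLinearGroup (Fin n) ℂ) :
    (g : Matrix (Fin n) (Fin n) ℂ).det ≠ 0 := Matrix.GeneralLinearGroup.det_ne_zero g

theorem eval_det_X (g : Matrix.GeneralLinearGroup (Fin n) ℂ) :
    MvPolynomial.eval (fun ij => (g : Matrix (Fin n) (Fin n) ℂ) ij.1 ij.2)
      (Matrix.mvPolynomialX (Fin n) (Fin n) ℂ).det = (g : Matrix (Fin n) (Fin n) ℂ).det :=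
  Matrix.eval_det_mvPolynomialX _ _ _

theorem IsRatFun.const (c : ℂ) :
    IsRatFun fun _ : Matrix.GeneralLinearGroup (Fin n) ℂ => c :=
  ⟨MvPolynomial.C c, 0, fun g => by simp⟩

theorem IsRatFun.entry (i j : Fin n) :
    IsRatFun fun g : Matrix.GeneralLinearGroup (Fin n) ℂ =>
      (g : Matrix (Fin n) (Fin n) ℂ) i j :=
  ⟨MvPolynomial.X (i, j), 0, fun g => by simp⟩

theorem IsRatFun.add {a b : Matrix.GeneralLinearGroup (Fin n) ℂ → ℂ} (ha : IsRatFun a)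
    (hb : IsRatFun b) : IsRatFun fun g => a g + b g := by
  obtain ⟨Q, N, hQ⟩ := ha
  obtain ⟨R, M, hR⟩ := hb
  refine ⟨Q * (Matrix.mvPolynomialX (Fin n) (Fin n) ℂ).det ^ M +
    R * (Matrix.mvPolynomialX (Fin n) (Fin n) ℂ).det ^ N, N + M, fun g => ?_⟩
  have h := det_coe_ne_zero g
  dsimp only
  rw [hQ, hR, map_add, map_mul, map_mul, map_pow, map_pow, eval_det_X, pow_add]
  field_simp

theorem IsRatFun.mul {a b : Matrix.GeneralLinearGroup (Fin n) ℂ → ℂ} (ha : IsRatFun a)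
    (hb : IsRatFun b) : IsRatFun fun g => a g * b g := by
  obtain ⟨Q, N, hQ⟩ := ha
  obtain ⟨R, M, hR⟩ := hb
  refine ⟨Q * R, N + M, fun g => ?_⟩
  dsimp only
  rw [hQ, hR, map_mul, pow_add, div_mul_div_comm]

theorem IsRatFun.sum {ι : Type*} (s : Finset ι)
    {b : ι → Matrix.GeneralLinearGroup (Fin n) ℂ → ℂ} (hb : ∀ k, IsRatFun (b k)) :
    IsRatFun fun g => ∑ k ∈ s, b k g := by
  classical
  induction s using Finset.induction_on with
  | empty => simpa using IsRatFun.const 0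
  | insert a s ha ih => simpa only [Finset.sum_insert ha] using (hb a).add ih

theorem IsRatFun.det_zpow (k : ℤ) :
    IsRatFun fun g : Matrix.GeneralLinearGroup (Fin n) ℂ =>
      (g : Matrix (Fin n) (Fin n) ℂ).det ^ k := by
  obtain ⟨m, rfl | rfl⟩ := k.eq_nat_or_neg
  · exact ⟨(Matrix.mvPolynomialX (Fin n) (Fin n) ℂ).det ^ m, 0, fun g => by
      rw [map_pow, eval_det_X]; simp⟩
  · exact ⟨1, m, fun g => by simp⟩

theorem IsRatFun.translate {b : Matrix.GeneralLinearGroup (Fin n) ℂ → ℂ} (hb : IsRatFun b)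
    (c : Matrix.GeneralLinearGroup (Fin n) ℂ) : IsRatFun fun g => b (g * c) := by
  obtain ⟨Q, N, hQ⟩ := hb
  have h1 : IsRatFun fun g : Matrix.GeneralLinearGroup (Fin n) ℂ =>
      MvPolynomial.eval (fun ij => ((g * c : Matrix.GeneralLinearGroup (Fin n) ℂ) :
        Matrix (Fin n) (Fin n) ℂ) ij.1 ij.2) Q := by
    clear hQ
    induction Q using MvPolynomial.induction_on with
    | C a => simpa using IsRatFun.const a
    | add p q hp hq => simpa using hp.add hq
    | mul_X p ij hp =>
      simp only [map_mul, MvPolynomial.eval_X]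
      refine hp.mul ?_
      simp only [Units.val_mul, Matrix.mul_apply]
      exact IsRatFun.sum _ fun k => (IsRatFun.entry _ _).mul (IsRatFun.const _)
  have h2 := h1.mul ((IsRatFun.det_zpow (-(N : ℤ))).mul
    (IsRatFun.const ((c : Matrix (Fin n) (Fin n) ℂ).det ^ (-(N : ℤ)))))
  refine (congrArg IsRatFun (funext fun g => ?_)).mpr h2
  rw [hQ, Units.val_mul, Matrix.det_mul, mul_pow, zpow_neg, zpow_neg, zpow_natCast, zpow_natCast,
    ← mul_inv, ← div_eq_mul_inv]

/-- Functions whose right translates depend rationally on the translation and span a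
finite-dimensional space. -/
def IsSplit (f : Matrix.GeneralLinearGroup (Fin n) ℂ → ℂ) : Prop :=
  ∃ (ι : Type) (_ : Fintype ι) (a b : ι → Matrix.GeneralLinearGroup (Fin n) ℂ → ℂ),
    (∀ k, IsRatFun (b k)) ∧ ∀ x g, f (x * g) = ∑ k, a k x * b k g

theorem IsSplit.of_mul {f b : Matrix.GeneralLinearGroup (Fin n) ℂ → ℂ} (hb : IsRatFun b)
    (h : ∀ x g, f (x * g) = f x * b g) : IsSplit f :=
  ⟨Unit, inferInstance, fun _ => f, fun _ => b, fun _ => hb, fun x g => by simp [h]⟩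

theorem IsSplit.const (c : ℂ) : IsSplit fun _ : Matrix.GeneralLinearGroup (Fin n) ℂ => c :=
  IsSplit.of_mul (IsRatFun.const 1) fun _ _ => by simp

theorem IsSplit.entry (i j : Fin n) :
    IsSplit fun g : Matrix.GeneralLinearGroup (Fin n) ℂ => (g : Matrix (Fin n) (Fin n) ℂ) i j :=
  ⟨Fin n, inferInstance, fun k g => (g : Matrix (Fin n) (Fin n) ℂ) i k,
    fun k g => (g : Matrix (Fin n) (Fin n) ℂ) k j, fun k => IsRatFun.entry k j,
    fun x g => by simp only [Units.val_mul, Matrix.mul_apply]⟩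

theorem IsSplit.add {f h : Matrix.GeneralLinearGroup (Fin n) ℂ → ℂ} (hf : IsSplit f)
    (hh : IsSplit h) : IsSplit fun g => f g + h g := by
  obtain ⟨ι, _, a, b, hb, hab⟩ := hf
  obtain ⟨κ, _, c, d, hd, hcd⟩ := hh
  exact ⟨ι ⊕ κ, inferInstance, Sum.elim a c, Sum.elim b d,
    fun k => by cases k <;> simp [hb, hd], fun x g => by simp [hab, hcd]⟩

theorem IsSplit.mul {f h : Matrix.GeneralLinearGroup (Fin n) ℂ → ℂ} (hf : IsSplit f)
    (hh : IsSplit h) : IsSplit fun g => f g * h g := by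
  obtain ⟨ι, _, a, b, hb, hab⟩ := hf
  obtain ⟨κ, _, c, d, hd, hcd⟩ := hh
  refine ⟨ι × κ, inferInstance, fun k x => a k.1 x * c k.2 x, fun k g => b k.1 g * d k.2 g,
    fun k => (hb _).mul (hd _), fun x g => ?_⟩
  simp only [hab, hcd]
  rw [Finset.sum_mul_sum, ← Finset.sum_product']
  exact Finset.sum_congr rfl fun k _ => by ring

theorem IsSplit.sum {ι : Type*} (s : Finset ι)
    {f : ι → Matrix.GeneralLinearGroup (Fin n) ℂ → ℂ} (hf : ∀ k, IsSplit (f k)) :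
    IsSplit fun g => ∑ k ∈ s, f k g := by
  classical
  induction s using Finset.induction_on with
  | empty => simpa using IsSplit.const 0
  | insert a s ha ih => simpa only [Finset.sum_insert ha] using (hf a).add ih

theorem IsSplit.prod {ι : Type*} (s : Finset ι)
    {f : ι → Matrix.GeneralLinearGroup (Fin n) ℂ → ℂ} (hf : ∀ k, IsSplit (f k)) :
    IsSplit fun g => ∏ k ∈ s, f k g := by
  classical
  induction s using Finset.induction_on with
  | empty => simpa using IsSplit.const 1
  | insert a s ha ih => simpa only [Finset.prod_insert ha] using (hf a).mul ih

theorem IsSplit.pow {f : Matrix.GeneralLinearGroup (Fin n) ℂ → ℂ} (hf : IsSplit f) (m : ℕ) :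
    IsSplit fun g => f g ^ m := by
  induction m with
  | zero => simpa using IsSplit.const 1
  | succ m ih => simpa only [pow_succ] using ih.mul hf

theorem IsSplit.translate {f : Matrix.GeneralLinearGroup (Fin n) ℂ → ℂ} (hf : IsSplit f)
    (c : Matrix.GeneralLinearGroup (Fin n) ℂ) : IsSplit fun g => f (g * c) := by
  obtain ⟨ι, _, a, b, hb, hab⟩ := hf
  exact ⟨ι, inferInstance, a, fun k g => b k (g * c), fun k => (hb k).translate c,
    fun x g => by simp only [mul_assoc, hab]⟩

/-- The right regular representation on functions. -/
def rightRegular (n : ℕ) : Representation ℂ (Matrix.GeneralLinearGroup (Fin n) ℂ)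
    (Matrix.GeneralLinearGroup (Fin n) ℂ → ℂ) where
  toFun g := LinearMap.funLeft ℂ ℂ fun x => x * g
  map_one' := by ext f x; simp [LinearMap.funLeft_apply]
  map_mul' g h := by ext f x; simp [LinearMap.funLeft_apply, mul_assoc]

theorem rightRegular_apply (g x : Matrix.GeneralLinearGroup (Fin n) ℂ)
    (f : Matrix.GeneralLinearGroup (Fin n) ℂ → ℂ) : rightRegular n g f x = f (x * g) := rfl

/-- The subrepresentation of the regular representation generated by a function. -/
def translateSpan (f : Matrix.GeneralLinearGroup (Fin n) ℂ → ℂ) :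
    Subrepresentation (rightRegular n) where
  toSubmodule := Submodule.span ℂ (Set.range fun g => rightRegular n g f)
  apply_mem_toSubmodule g v hv := by
    induction hv using Submodule.span_induction with
    | mem x hx =>
      obtain ⟨h, rfl⟩ := hx
      refine Submodule.subset_span ⟨g * h, ?_⟩
      dsimp only
      rw [map_mul]; rfl
    | zero => rw [map_zero]; exact Submodule.zero_mem _
    | add x y _ _ hx hy => rw [map_add]; exact Submodule.add_mem _ hx hy
    | smul c x _ hx => rw [map_smul]; exact Submodule.smul_mem _ c hx

theorem self_mem_translateSpan (f : Matrix.GeneralLinearGroup (Fin n) ℂ → ℂ) :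
    f ∈ (translateSpan f).toSubmodule :=
  Submodule.subset_span ⟨1, by dsimp only; rw [map_one]; rfl⟩

theorem IsSplit.finiteDimensional {f : Matrix.GeneralLinearGroup (Fin n) ℂ → ℂ}
    (hf : IsSplit f) : FiniteDimensional ℂ (translateSpan f).toSubmodule := by
  obtain ⟨ι, _, a, b, hb, hab⟩ := hf
  have hle : (translateSpan f).toSubmodule ≤ Submodule.span ℂ (Set.range a) := by
    refine Submodule.span_le.mpr ?_
    rintro _ ⟨g, rfl⟩
    have : rightRegular n g f = ∑ k, b k g • a k := by
      funext x
      rw [rightRegular_apply, hab, Finset.sum_apply]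
      exact Finset.sum_congr rfl fun k _ => by simp [mul_comm]
    dsimp only
    rw [this]
    exact Submodule.sum_mem _ fun k _ => Submodule.smul_mem _ _ (Submodule.subset_span ⟨k, rfl⟩)
  have := FiniteDimensional.span_of_finite ℂ (Set.finite_range a)
  exact Submodule.finiteDimensional_of_le hle

theorem IsSplit.isRatFun_dual {f : Matrix.GeneralLinearGroup (Fin n) ℂ → ℂ} (hf : IsSplit f)
    (φ : Module.Dual ℂ (Matrix.GeneralLinearGroup (Fin n) ℂ → ℂ)) :
    IsRatFun fun g => φ (rightRegular n g f) := by
  obtain ⟨ι, _, a, b, hb, hab⟩ := hf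
  have : ∀ g, φ (rightRegular n g f) = ∑ k, b k g * φ (a k) := by
    intro g
    have h : rightRegular n g f = ∑ k, b k g • a k := by
      funext x
      rw [rightRegular_apply, hab, Finset.sum_apply]
      exact Finset.sum_congr rfl fun k _ => by simp [mul_comm]
    rw [h, map_sum]
    exact Finset.sum_congr rfl fun k _ => by rw [map_smul, smul_eq_mul]
  simp only [this]
  exact IsRatFun.sum _ fun k => (hb k).mul (IsRatFun.const _)

theorem IsSplit.isRational {f : Matrix.GeneralLinearGroup (Fin n) ℂ → ℂ} (hf : IsSplit f) :
    IsRational (translateSpan f).toRepresentation := by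
  rintro φ ⟨v, hv⟩
  -- The functions `a k` of a splitting need not lie in the span of the translates, so the
  -- functional is extended to all functions.
  obtain ⟨ψ, hψ⟩ := LinearMap.exists_extend φ
  have hφ : ∀ x, φ x = ψ x := fun x => by rw [← hψ]; rfl
  have key : IsRatFun fun g => ψ (rightRegular n g v) := by
    induction hv using Submodule.span_induction with
    | mem x hx =>
      obtain ⟨c, rfl⟩ := hx
      exact (hf.translate c).isRatFun_dual ψ
    | zero => simpa using IsRatFun.const 0
    | add x y _ _ hx hy => simpa using hx.add hy
    | smul c x _ hx => simpa using (IsRatFun.const c).mul hx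
  obtain ⟨Q, N, hQ⟩ := key
  exact ⟨Q, N, fun g => by rw [hφ, ← hQ]; rfl⟩

end Rational

/-! ### Irreducible quotients of cyclic highest weight representations -/

section Quotient

variable {n : ℕ} {V : Type*} [AddCommGroup V] [Module ℂ V]
  {ρ : Representation ℂ (Matrix.GeneralLinearGroup (Fin n) ℂ) V}

/-- A cyclic highest weight representation has an irreducible quotient of the same highest
weight. -/
theorem exists_irreducible_quotient [FiniteDimensional ℂ V] (hrat : IsRational ρ)
    {w : Fin n → ℤ} {v : V} (hv0 : v ≠ 0)
    (hcyc : ∀ K : Submodule ℂ V, (∀ g, K ≤ K.comap (ρ g)) → v ∈ K → K = ⊤)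
    (hv : ∀ b : Matrix.GeneralLinearGroup (Fin n) ℂ,
      (∀ i j, j < i → (b : Matrix (Fin n) (Fin n) ℂ) i j = 0) →
        ρ b v = (∏ i, (b : Matrix (Fin n) (Fin n) ℂ) i i ^ w i) • v) :
    ∃ (N : Submodule ℂ V) (hN : ∀ g, N ≤ N.comap (ρ g)),
      IsIrrepOfHighestWeight (ρ.quotient N hN) w := by
  -- `N` is maximal among invariant subspaces avoiding `v`. An invariant subspace containing `N`
  -- either contains `v`, hence is everything by cyclicity, or equals `N`.
  obtain ⟨N, ⟨hN, hvN⟩, hmax⟩ := WellFounded.has_min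
    (wellFounded_gt : WellFounded ((· > ·) : Submodule ℂ V → Submodule ℂ V → Prop))
    {K | (∀ g, K ≤ K.comap (ρ g)) ∧ v ∉ K} ⟨⊥, fun g => by
      intro x hx
      rw [Submodule.mem_bot] at hx
      rw [hx]
      exact Submodule.zero_mem _, by simpa using hv0⟩
  have hq : ∀ g x, ρ.quotient N hN g (N.mkQ x) = N.mkQ (ρ g x) := fun g x => rfl
  have hvq : N.mkQ v ≠ 0 := by
    rw [Submodule.mkQ_apply, Ne, Submodule.Quotient.mk_eq_zero]
    exact hvN
  refine ⟨N, hN, inferInstance, ?_, ?_, N.mkQ v, hvq, fun b hb => ?_⟩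
  · intro f x
    obtain ⟨x, rfl⟩ := N.mkQ_surjective x
    exact hrat (f ∘ₗ N.mkQ) x
  · have hne : (⊥ : Subrepresentation (ρ.quotient N hN)) ≠ ⊤ := by
      intro h
      have h1 : N.mkQ v ∈ (⊤ : Subrepresentation (ρ.quotient N hN)).toSubmodule :=
        Submodule.mem_top
      rw [← h] at h1
      exact hvq ((Submodule.mem_bot ℂ).mp h1)
    refine { toNontrivial := ⟨⊥, ⊤, hne⟩, eq_bot_or_eq_top := fun S => ?_ }
    have hK : ∀ g, S.toSubmodule.comap N.mkQ ≤ (S.toSubmodule.comap N.mkQ).comap (ρ g) := by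
      intro g x hx
      exact S.apply_mem_toSubmodule g hx
    have hNK : N ≤ S.toSubmodule.comap N.mkQ := by
      intro x hx
      rw [Submodule.mem_comap, Submodule.mkQ_apply, (Submodule.Quotient.mk_eq_zero N).mpr hx]
      exact Submodule.zero_mem _
    by_cases hvK : v ∈ S.toSubmodule.comap N.mkQ
    · right
      have h1 := hcyc _ hK hvK
      apply Subrepresentation.toSubmodule_injective
      change S.toSubmodule = ⊤
      rw [eq_top_iff]
      intro y _
      obtain ⟨x, rfl⟩ := N.mkQ_surjective y
      have : x ∈ S.toSubmodule.comap N.mkQ := h1 ▸ Submodule.mem_top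
      exact this
    · left
      have h1 := hmax _ ⟨hK, hvK⟩
      have h2 : N = S.toSubmodule.comap N.mkQ := eq_of_le_of_not_lt hNK h1
      apply Subrepresentation.toSubmodule_injective
      change S.toSubmodule = ⊥
      rw [eq_bot_iff]
      intro y hy
      obtain ⟨x, rfl⟩ := N.mkQ_surjective y
      have : x ∈ N := h2 ▸ hy
      rw [Submodule.mem_bot, Submodule.mkQ_apply]
      exact (Submodule.Quotient.mk_eq_zero N).mpr this
  · rw [hq, hv b hb, map_smul]

end Quotient

/-! ### Leading minors and the highest weight function -/

section LeadingMinors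

variable {n : ℕ}

/-- The leading principal minor with rows and columns `0, …, r`. -/
noncomputable def leadingMinor (r : Fin n) (M : Matrix (Fin n) (Fin n) ℂ) : ℂ :=
  (M.toSquareBlockProp fun i => i ≤ r).det

theorem leadingMinor_one (r : Fin n) : leadingMinor r 1 = 1 := by
  rw [leadingMinor]
  have : (1 : Matrix (Fin n) (Fin n) ℂ).toSquareBlockProp (fun i => i ≤ r) = 1 := by
    ext i j
    simp [Matrix.toSquareBlockProp_def, Matrix.one_apply, Subtype.ext_iff]
  rw [this, Matrix.det_one]

/-- Columns of `b` up to `r` vanish below row `r`, so the leading block of the product is the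
product of the leading blocks. -/
theorem leadingMinor_mul (r : Fin n) (M b : Matrix (Fin n) (Fin n) ℂ)
    (hb : ∀ i j, j < i → b i j = 0) :
    leadingMinor r (M * b) = leadingMinor r M * ∏ i, if i ≤ r then b i i else 1 := by
  have h1 : (M * b).toSquareBlockProp (fun i => i ≤ r) =
      M.toSquareBlockProp (fun i => i ≤ r) * b.toSquareBlockProp (fun i => i ≤ r) := by
    ext i j
    simp only [Matrix.toSquareBlockProp_def, Matrix.of_apply, Matrix.mul_apply]
    rw [← Finset.sum_subtype (Finset.univ.filter fun k => k ≤ r) (by simp)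
      fun k => M i k * b k j, Finset.sum_filter_of_ne]
    intro k _ hk
    by_contra hkr
    exact hk (by rw [hb k j (lt_of_le_of_lt j.2 (not_le.mp hkr)), mul_zero])
  have h2 : (b.toSquareBlockProp (fun i => i ≤ r)).det = ∏ i, if i ≤ r then b i i else 1 := by
    rw [Matrix.det_of_isUpperTriangular]
    · rw [← Finset.prod_filter]
      exact (Finset.prod_subtype (Finset.univ.filter fun k => k ≤ r) (by simp)
        fun k => b k k).symm
    · intro i j hij
      exact hb _ _ hij
  rw [leadingMinor, h1, Matrix.det_mul, h2]; rfl

theorem IsSplit.leadingMinor (r : Fin n) :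
    IsSplit fun g : Matrix.GeneralLinearGroup (Fin n) ℂ =>
      leadingMinor r (g : Matrix (Fin n) (Fin n) ℂ) := by
  simp only [QWhittaker.leadingMinor, Matrix.det_apply']
  exact IsSplit.sum _ fun σ => (IsSplit.const _).mul (IsSplit.prod _ fun i => IsSplit.entry _ _)

theorem sum_sub_succ {ℓ : ℕ} (w : Fin (ℓ + 1) → ℤ) (i : Fin (ℓ + 1)) :
    (∑ r : Fin ℓ, if i ≤ r.castSucc then w r.castSucc - w r.succ else 0) + w (Fin.last ℓ) =
      w i := by
  induction ℓ with
  | zero => rw [Fin.fin_one_eq_zero i]; simp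
  | succ ℓ ih =>
    rw [Fin.sum_univ_castSucc]
    induction i using Fin.lastCases with
    | last =>
      rw [Finset.sum_eq_zero]
      · simp [Fin.last_le_iff]
      · intro r _
        rw [if_neg]
        simp [Fin.last_le_iff]
    | cast i =>
      have h := ih (fun j => w j.castSucc) i
      have h2 : i.castSucc ≤ (Fin.last ℓ).castSucc :=
        Fin.castSucc_le_castSucc_iff.mpr (Fin.le_last i)
      rw [if_pos h2, ← h]
      simp only [Fin.castSucc_le_castSucc_iff, Fin.succ_castSucc, Fin.succ_last]
      ring

/-- A function on the group that spans a highest weight representation. -/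
noncomputable def highestWeightFun {ℓ : ℕ} (w : Fin (ℓ + 1) → ℤ)
    (g : Matrix.GeneralLinearGroup (Fin (ℓ + 1)) ℂ) : ℂ :=
  -- Proper minors may vanish on the group, so they get natural exponents; `toNat` loses nothing for
  -- decreasing `w`. Only the determinant may carry a negative power.
  (∏ r : Fin ℓ, leadingMinor r.castSucc (g : Matrix (Fin (ℓ + 1)) (Fin (ℓ + 1)) ℂ) ^
    (w r.castSucc - w r.succ).toNat) *
    (g : Matrix (Fin (ℓ + 1)) (Fin (ℓ + 1)) ℂ).det ^ w (Fin.last ℓ)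

theorem highestWeightFun_one {ℓ : ℕ} (w : Fin (ℓ + 1) → ℤ) : highestWeightFun w 1 = 1 := by
  simp [highestWeightFun, leadingMinor_one]

theorem isSplit_highestWeightFun {ℓ : ℕ} (w : Fin (ℓ + 1) → ℤ) :
    IsSplit (highestWeightFun w) := by
  refine IsSplit.mul (IsSplit.prod _ fun r => (IsSplit.leadingMinor _).pow _)
    (IsSplit.of_mul (IsRatFun.det_zpow (w (Fin.last ℓ))) fun x g => ?_)
  rw [Units.val_mul, Matrix.det_mul, mul_zpow]

/-- The entry `b i i` occurs in every minor of index at least `i` and in the determinant; the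
exponents telescope to `w i`. -/
theorem highestWeightFun_mul {ℓ : ℕ} {w : Fin (ℓ + 1) → ℤ} (hw : Antitone w)
    (x b : Matrix.GeneralLinearGroup (Fin (ℓ + 1)) ℂ)
    (hb : ∀ i j, j < i → (b : Matrix (Fin (ℓ + 1)) (Fin (ℓ + 1)) ℂ) i j = 0) :
    highestWeightFun w (x * b) =
      (∏ i, (b : Matrix (Fin (ℓ + 1)) (Fin (ℓ + 1)) ℂ) i i ^ w i) * highestWeightFun w x := by
  set B : Matrix (Fin (ℓ + 1)) (Fin (ℓ + 1)) ℂ := b.val with hB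
  have hdet : B.det = ∏ i, B i i := Matrix.det_of_isUpperTriangular fun i j hij => hb i j hij
  have hne : ∀ i, B i i ≠ 0 := by
    have := det_coe_ne_zero b
    rw [← hB, hdet, Finset.prod_ne_zero_iff] at this
    exact fun i => this i (Finset.mem_univ i)
  have hprod : ∏ i, B i i ^ w i =
      (∏ r : Fin ℓ, (∏ i, if i ≤ r.castSucc then B i i else 1) ^ (w r.castSucc - w r.succ).toNat) *
        B.det ^ w (Fin.last ℓ) := by
    rw [hdet, ← Finset.prod_zpow]
    simp only [← Finset.prod_pow]
    rw [Finset.prod_comm, ← Finset.prod_mul_distrib]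
    refine Finset.prod_congr rfl fun i _ => ?_
    conv_lhs => rw [← sum_sub_succ w i, zpow_add₀ (hne i), zpow_finset_sum (hne i)]
    congr 1
    refine Finset.prod_congr rfl fun r _ => ?_
    split_ifs
    · rw [← zpow_natCast, Int.toNat_of_nonneg (sub_nonneg.mpr (hw (Fin.castSucc_le_succ r)))]
    · simp
  have hmin : ∀ r : Fin ℓ, leadingMinor r.castSucc (x.val * B) =
      leadingMinor r.castSucc x.val * ∏ i, if i ≤ r.castSucc then B i i else 1 :=
    fun r => leadingMinor_mul _ _ _ hb
  rw [highestWeightFun, Units.val_mul, ← hB, Matrix.det_mul, mul_zpow, hprod, highestWeightFun,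
    Finset.prod_congr rfl fun r _ => by rw [hmin r, mul_pow], Finset.prod_mul_distrib]
  ring

end LeadingMinors

theorem exists_isIrrepOfHighestWeight {ℓ : ℕ} {w : Fin (ℓ + 1) → ℤ} (hw : Antitone w) :
    ∃ (V : Type) (_ : AddCommGroup V) (_ : Module ℂ V)
      (ρ : Representation ℂ (Matrix.GeneralLinearGroup (Fin (ℓ + 1)) ℂ) V),
      IsIrrepOfHighestWeight ρ w := by
  set f := highestWeightFun w with hf
  have hs : IsSplit f := isSplit_highestWeightFun w
  have := hs.finiteDimensional
  obtain ⟨N, hN, h⟩ := exists_irreducible_quotient (w := w) hs.isRational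
    (v := ⟨f, self_mem_translateSpan f⟩) (by
      intro h
      have h1 := congrFun (congrArg Subtype.val h) 1
      rw [hf] at h1
      change highestWeightFun w 1 = 0 at h1
      rw [highestWeightFun_one] at h1
      exact one_ne_zero h1) (by
      intro K hK hfK
      rw [eq_top_iff]
      rintro ⟨x, hx⟩ -
      induction hx using Submodule.span_induction with
      | mem x hx =>
        obtain ⟨g, rfl⟩ := hx
        exact hK g hfK
      | zero => exact Submodule.zero_mem _
      | add x y hx' hy' hx hy =>
        exact Submodule.add_mem _ hx hy
      | smul c x hx' hx => exact Submodule.smul_mem _ c hx) (by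
      intro b hb
      apply Subtype.ext
      funext x
      exact highestWeightFun_mul hw x b hb)
  exact ⟨_, _, _, _, h⟩

end QWhittaker

theorem mainTheorem4 (ℓ : ℕ) (p : Fin (ℓ + 1) → ℤ) (hp : Monotone p) :
    (∀ (z : Fin (ℓ + 1) → ℂˣ) (lam : ℝ → Fin (ℓ + 1) → ℂ),
        (∀ᶠ q : ℝ in 𝓝[>] (0 : ℝ), ∀ i, (q : ℂ) ^ lam q i = z i) →
        Tendsto (fun q : ℝ => QWhittaker.qWhittakerFun ℓ q (lam q) p) (𝓝[>] (0 : ℝ))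
          (𝓝 (QWhittaker.gzChar ℓ p z))) ∧
    (∀ r : ℕ, 1 ≤ r → r ≤ ℓ + 1 → ∀ z : Fin (ℓ + 1) → ℂˣ,
        QWhittaker.fundChar r z =
          ∑ I ∈ Finset.powersetCard r (Finset.univ : Finset (Fin (ℓ + 1))),
            ∏ i ∈ I, (z i : ℂ) ∧
        QWhittaker.fundChar r z * QWhittaker.gzChar ℓ p z =
          ∑ I ∈ Finset.powersetCard r (Finset.univ : Finset (Fin (ℓ + 1))),
            QWhittaker.gzChar ℓ (QWhittaker.shift p I) z) ∧
    (∃ (V : Type) (_ : AddCommGroup V) (_ : Module ℂ V)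
        (ρ : Representation ℂ (Matrix.GeneralLinearGroup (Fin (ℓ + 1)) ℂ) V),
        QWhittaker.IsIrrepOfHighestWeight ρ (fun i => p i.rev) ∧
        ∀ z : Fin (ℓ + 1) → ℂˣ,
          ρ.character (QWhittaker.torusElt z) = QWhittaker.gzChar ℓ p z) ∧
    (∀ (V : Type*) [AddCommGroup V] [Module ℂ V]
        (ρ : Representation ℂ (Matrix.GeneralLinearGroup (Fin (ℓ + 1)) ℂ) V),
        QWhittaker.IsIrrepOfHighestWeight ρ (fun i => p i.rev) →
        ∀ z : Fin (ℓ + 1) → ℂˣ,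
          ρ.character (QWhittaker.torusElt z) = QWhittaker.gzChar ℓ p z) := by
  refine ⟨fun z lam h => QWhittaker.tendsto_qWhittakerFun hp z lam h,
    fun r _ _ z => ⟨QWhittaker.fundChar_eq r z, QWhittaker.fundChar_mul_gzChar hp r z⟩, ?_,
    fun V _ _ ρ h z => QWhittaker.character_eq_gzChar hp ρ h z⟩
  obtain ⟨V, _, _, ρ, h⟩ := QWhittaker.exists_isIrrepOfHighestWeight (w := fun i => p i.rev)
    fun i j hij => hp (Fin.rev_le_rev.mpr hij)
  exact ⟨V, _, _, ρ, h, QWhittaker.character_eq_gzChar hp ρ h⟩
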